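/- Setting. There are $n$ agents; agent $i$ has a private value $v_i$ from a known set $V_i\subseteq\mathbb R$, and $V=V_1\times\dots\times V_n$. An allocation is a vector $x\in\mathbb R^n$; a feasibility constraint is a set $\mathcal F\subseteq\mathbb R^n$; the social welfare of $x$ at $v$ is $v\cdot x$. An algorithm $\mathcal A$ maps each $v\in V$ to a (possibly random) allocation; it is an algorithm for $\mathcal F$ if it only returns elements of $\mathcal F$. Put $OPT_{\mathcal F}(v)=\max_{x\in\mathcal F}v\cdot x$ and $$approx_{\mathcal F}(\mathcal A)=\min_{v\in V}\frac{\mathbf E[v\cdot\mathcal A(v)]}{OPT_{\mathcal F}(v)}.$$ $\mathcal A$ is truthful in expectation (TIE) if there is a payment rule $p:V\to\mathbb R^n$ such that $\mathbf E[v_i\mathcal A_i(v)-p_i(v)]\ge\mathbf E[v_i\mathcal A_i(b_i,v_{-i})-p_i(b_i,v_{-i})]$ for all $i$, all $v\in V$ and all $b_i\in V_i$. A black-box transformation $\mathcal T$ is a randomized procedure that, for each $n$ and each input $v\in V$, adaptively queries a deterministic algorithm $\mathcal A$ at profiles of $V$, tosses coins (of any bias), and returns an allocation $\mathcal T(\mathcal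 A)(v)$. It may depend on $n$ and on the sets $V_i$, but accesses $\mathcal A$ only through queries and is given no information on $\mathcal F$. It is polytime if for some polynomial $p$ it makes, on every input and for every $\mathcal A$, at most $p(n)$ steps; only queries and coin tosses are counted as steps, any other computation being free, so that every transformation with polynomial running time in the usual sense is included. Whenever $\mathcal A$ is an algorithm for $\mathcal F$, $\mathcal T(\mathcal A)$ is required to be an algorithm for $\mathcal F$ as well. $\mathcal T$ is TIE if $\mathcal T(\mathcal A)$ is TIE for every $\mathcal A$. Theorem. There are a constant $c>0$ and numbers $\ell_n\in(0,1)$, $n\in\mathbb N$, such that the following holds for the value sets $V_1=\dots=V_n=\{\ell_n,1\}$. For every polytime TIE black-box transformation $\mathcal T$ and all sufficiently large $n$ (depending on $\mathcal T$) there are a finite feasibility constraint $\mathcal F\subseteq[0,\infty)^n$ and a deterministic algorithm $\mathcal A$ for $\mathcal F$ with $$\frac{approx_{\mathcal F}(\mathcal A)}{approx_{\mathcal F}(\mathcal T(\mathcal A))}\ge n^c;$$ more precisely, also $approx_{\mathcal F}(\mathcal A)\ge\frac16$ and $approx_{\mathcal F}(\mathcal T(\mathcal A))\le 2\,n^{-1/20}$.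 -/

import Mathlib

namespace BlackBox

/-- An allocation to `n` agents: agent `i` is allocated the amount `x i`. -/
abbrev Allocation (n : ℕ) : Type := Fin n → ℝ

/-- A profile of values, the value of agent `i` being drawn from the known set `D i`. -/
abbrev Profile {n : ℕ} (D : Fin n → Set ℝ) : Type := (i : Fin n) → D i

/-- The social welfare `v · x`. -/
def welfare {n : ℕ} {D : Fin n → Set ℝ} (x : Allocation n) (v : Profile D) : ℝ :=
  ∑ i, (v i : ℝ) * x i

/-- A deterministic algorithm, as an allocation rule. -/
abbrev DetAlgorithm {n : ℕ} (D : Fin n → Set ℝ) : Type := Profile D → Allocation n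

/-- A randomized algorithm: for each profile a distribution over allocations. -/
abbrev Algorithm {n : ℕ} (D : Fin n → Set ℝ) : Type := Profile D → PMF (Allocation n)

/-- A deterministic algorithm, regarded as a randomized one. -/
noncomputable def DetAlgorithm.toAlgorithm {n : ℕ} {D : Fin n → Set ℝ}
    (A : DetAlgorithm D) : Algorithm D :=
  fun v => PMF.pure (A v)

/-- `A` is an algorithm for the feasibility constraint `F`: it only returns elements of `F`. -/
def Algorithm.IsFor {n : ℕ} {D : Fin n → Set ℝ} (A : Algorithm D)
    (F : Set (Allocation n)) : Prop :=
  ∀ v, ∀ x ∈ (A v).support, x ∈ F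

/-- The expectation of `f` under a distribution over allocations. (All distributions used below
have finite support.) -/
noncomputable def expect {n : ℕ} (μ : PMF (Allocation n)) (f : Allocation n → ℝ) : ℝ :=
  ∑' x, (μ x).toReal * f x

/-- The optimal welfare over `F` at the profile `v`. -/
noncomputable def opt {n : ℕ} {D : Fin n → Set ℝ} (F : Set (Allocation n))
    (v : Profile D) : ℝ :=
  sSup ((fun x => welfare x v) '' F)

/-- The worst-case approximation ratio of `A` for `F`: the least value, over all profiles, of the
expected welfare of `A` divided by the optimal welfare. -/
noncomputable def approx {n : ℕ} {D : Fin n → Set ℝ} (F : Set (Allocation n))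
    (A : Algorithm D) : ℝ :=
  ⨅ v : Profile D, expect (A v) (fun x => welfare x v) / opt F v

/-- `A` is truthful in expectation: for some payment rule `pay`, no agent can raise its expected
utility by a misreport, whatever the other agents report. Here `v` consists of the true value
`v i` of agent `i` and of the reports of the others, and `b` is a possible report of `i`. -/
def Algorithm.IsTIE {n : ℕ} {D : Fin n → Set ℝ} (A : Algorithm D) : Prop :=
  ∃ pay : Profile D → Fin n → ℝ, ∀ (i : Fin n) (v : Profile D) (b : D i),
    expect (A (Function.update v i b))
        (fun x => (v i : ℝ) * x i - pay (Function.update v i b) i) ≤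
      expect (A v) (fun x => (v i : ℝ) * x i - pay v i)

/-- A randomized program with black-box access to an algorithm. It halts with an allocation, or
queries the black box at a profile and goes on depending on the answer, or tosses a coin of
arbitrary bias and goes on depending on the outcome. Between these steps the program may compute
anything, so every randomized oracle algorithm of bounded running time unfolds into such a
program. -/
inductive Program {n : ℕ} (D : Fin n → Set ℝ) : Type
  | halt (x : Allocation n) : Program D
  | query (w : Profile D) (next : Allocation n → Program D) : Program D
  | toss (coin : PMF Bool) (next : Bool → Program D) : Program D

/-- The distribution of the allocation returned by a program run with black box `A`. -/
noncomputable def Program.run {n : ℕ} {D : Fin n → Set ℝ} (A : DetAlgorithm D) :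
    Program D → PMF (Allocation n)
  | .halt x => PMF.pure x
  | .query w next => (next (A w)).run A
  | .toss coin next => coin.bind fun b => (next b).run A

/-- The number of steps (queries and coin tosses) of a program run with black box `A`, in the
worst case over the coin tosses. -/
def Program.time {n : ℕ} {D : Fin n → Set ℝ} (A : DetAlgorithm D) : Program D → ℕ
  | .halt _ => 0
  | .query w next => (next (A w)).time A + 1
  | .toss _ next => max ((next true).time A) ((next false).time A) + 1

/-- A black-box transformation for the value domains `D n i`: a program for every number `n` of
agents and every profile. It is given neither the algorithm nor the feasibility constraint. -/
def Transformation (D : (n : ℕ) → Fin n → Set ℝ) : Type :=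
  (n : ℕ) → Profile (D n) → Program (D n)

/-- The algorithm `T(A)`. -/
noncomputable def Transformation.apply {D : (n : ℕ) → Fin n → Set ℝ} (T : Transformation D)
    {n : ℕ} (A : DetAlgorithm (D n)) : Algorithm (D n) :=
  fun v => (T n v).run A

/-- The number of steps is at most a polynomial in the number of agents. -/
def Transformation.IsPolytime {D : (n : ℕ) → Fin n → Set ℝ} (T : Transformation D) : Prop :=
  ∃ p : Polynomial ℕ, ∀ (n : ℕ) (A : DetAlgorithm (D n)) (v : Profile (D n)),
    (T n v).time A ≤ p.eval n

/-- Whenever `A` is an algorithm for `F`, so is `T(A)`. -/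
def Transformation.IsFeasible {D : (n : ℕ) → Fin n → Set ℝ} (T : Transformation D) : Prop :=
  ∀ (n : ℕ) (F : Set (Allocation n)) (A : DetAlgorithm (D n)),
    A.toAlgorithm.IsFor F → (T.apply A).IsFor F

/-- `T` is truthful in expectation: so is `T(A)` for every `A`. -/
def Transformation.IsTIE {D : (n : ℕ) → Fin n → Set ℝ} (T : Transformation D) : Prop :=
  ∀ (n : ℕ) (A : DetAlgorithm (D n)), (T.apply A).IsTIE

end BlackBox

/-! The agents are hidden by a random placement in blocks of left and right slots, with one
distinguished slot on each side of a block. Three allocations are feasible: flat (`γ` for everyone),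
broad (`α` on left slots) and sharp (`1` on both distinguished slots, `α` on the other left slots).
Let `v` give value `1` exactly to the undistinguished left slots, and `u` to all left slots.

At `v` the broad allocation stays hidden. Exchanging the two distinguished slots in random blocks
changes neither `v` nor the sharp allocation. At any fixed profile `mixedRule` then almost surely
chooses between sharp and flat only, so a program with few steps does not meet broad
(`sum_run_broad_le`). As flat is poor at `v`, a good ratio forces sharp to be returned there with
noticeable probability.

At `u` the sharp allocation stays hidden. Moving the distinguished slots to random positions on
their own sides changes neither `u` nor the broad allocation. At any fixed profile the algorithm
then almost surely returns the better of flat and broad (`sum_run_sharp_le`).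

Truthfulness contradicts this. Every feasible allocation treats the left distinguished agents alike,
so their common expected amount cannot fall when they raise their values one by one, which leads
from `v` to `u` (`Algorithm.IsTIE.expect_le_union`). At `v` it is at least the probability of sharp;
at `u` it is at most `α + γ` plus a negligible probability of sharp. Hence sharp is rare at `v` as
well, and the ratio is small (`approx_transform_le`). -/

namespace BlackBox

open scoped ENNReal

/-! ### Hybrid argument for a random black box -/

/-- Replacing the black box by a random one that rarely differs at any given profile hardly
changes the output of a program. -/
theorem Program.sum_run_le {n : ℕ} {D : Fin n → Set ℝ} {Ω : Type*} [Fintype Ω]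
    (A : Ω → DetAlgorithm D) (A' : DetAlgorithm D) (N : ℝ≥0∞)
    (hN : ∀ v, ∑ ω, (if A ω v = A' v then 0 else 1 : ℝ≥0∞) ≤ N) (y : Ω → Allocation n)
    (p : Program D) :
    ∑ ω, p.run (A ω) (y ω) ≤ ∑ ω, p.run A' (y ω) + p.time A' * N := by
  induction p with
  | halt x => simp [Program.run]
  | query w next ih =>
    -- An `ω` whose answer deviates is charged the trivial bound `1`. The continuation is thus
    -- always the one for the answer of `A'`, which does not depend on `ω`, so adaptivity costs
    -- nothing.
    have h1 : ∀ ω, (Program.query w next).run (A ω) (y ω) ≤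
        (next (A' w)).run (A ω) (y ω) + (if A ω w = A' w then 0 else 1) := by
      intro ω
      split_ifs with h
      · simp [Program.run, h]
      · exact (PMF.coe_le_one _ _).trans le_add_self
    calc ∑ ω, (Program.query w next).run (A ω) (y ω)
        ≤ ∑ ω, (next (A' w)).run (A ω) (y ω) + ∑ ω, (if A ω w = A' w then 0 else 1 : ℝ≥0∞) := by
          rw [← Finset.sum_add_distrib]
          exact Finset.sum_le_sum fun ω _ => h1 ω
      _ ≤ (∑ ω, (next (A' w)).run A' (y ω) + (next (A' w)).time A' * N) + N :=
          add_le_add (ih _) (hN w)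
      _ = _ := by
          simp only [Program.run, Program.time]
          push_cast
          ring
  | toss coin next ih =>
    have hrun : ∀ (B : DetAlgorithm D) x, (Program.toss coin next).run B x =
        coin true * (next true).run B x + coin false * (next false).run B x := by
      intro B x
      simp only [Program.run, PMF.bind_apply, tsum_bool]
      rw [add_comm]
    have hcoin : coin true + coin false = 1 := by
      have := coin.tsum_coe
      rwa [tsum_bool, add_comm] at this
    have ht : ∀ b, (((next b).time A' : ℕ) : ℝ≥0∞) * N ≤
        ((Program.toss coin next).time A' : ℕ) * N := by
      intro b
      gcongr
      cases b <;> simp [Program.time] <;> omega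
    calc ∑ ω, (Program.toss coin next).run (A ω) (y ω)
        = coin true * ∑ ω, (next true).run (A ω) (y ω)
          + coin false * ∑ ω, (next false).run (A ω) (y ω) := by
          simp only [hrun, Finset.sum_add_distrib, Finset.mul_sum]
      _ ≤ coin true * (∑ ω, (next true).run A' (y ω) + (Program.toss coin next).time A' * N)
          + coin false *
            (∑ ω, (next false).run A' (y ω) + (Program.toss coin next).time A' * N) := by
          gcongr
          · exact (ih true).trans (add_le_add le_rfl (ht true))
          · exact (ih false).trans (add_le_add le_rfl (ht false))
      _ = (coin true * ∑ ω, (next true).run A' (y ω)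
          + coin false * ∑ ω, (next false).run A' (y ω))
          + (coin true + coin false) * ((Program.toss coin next).time A' * N) := by ring
      _ = _ := by
          simp only [hrun, Finset.sum_add_distrib, Finset.mul_sum, hcoin, one_mul]

/-! ### Expectations on finite menus, and monotonicity from truthfulness -/

theorem expect_eq_sum {n : ℕ} {μ : PMF (Allocation n)} {F : Finset (Allocation n)}
    (hμ : ∀ x ∈ μ.support, x ∈ F) (f : Allocation n → ℝ) :
    expect μ f = ∑ x ∈ F, (μ x).toReal * f x := by
  refine tsum_eq_sum fun x hx => ?_
  have : μ x = 0 := by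
    by_contra h
    exact hx (hμ x ((PMF.mem_support_iff _ _).2 h))
  simp [this]

theorem sum_toReal_eq_one {n : ℕ} {μ : PMF (Allocation n)} {F : Finset (Allocation n)}
    (hμ : ∀ x ∈ μ.support, x ∈ F) : ∑ x ∈ F, (μ x).toReal = 1 := by
  rw [← ENNReal.toReal_sum fun x _ => μ.apply_ne_top x]
  have : ∑ x ∈ F, μ x = ∑' x, μ x := by
    refine (tsum_eq_sum fun x hx => ?_).symm
    by_contra h
    exact hx (hμ x ((PMF.mem_support_iff _ _).2 h))
  rw [this, μ.tsum_coe, ENNReal.toReal_one]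

theorem expect_mul_sub {n : ℕ} {μ : PMF (Allocation n)} {F : Finset (Allocation n)}
    (hμ : ∀ x ∈ μ.support, x ∈ F) (f : Allocation n → ℝ) (a b : ℝ) :
    expect μ (fun x => a * f x - b) = a * expect μ f - b := by
  rw [expect_eq_sum hμ, expect_eq_sum hμ]
  simp only [mul_sub, Finset.sum_sub_distrib]
  rw [← Finset.sum_mul, sum_toReal_eq_one hμ, one_mul, Finset.mul_sum]
  congr 1
  exact Finset.sum_congr rfl fun x _ => by ring

theorem expect_mono {n : ℕ} {μ : PMF (Allocation n)} {F : Finset (Allocation n)}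
    (hμ : ∀ x ∈ μ.support, x ∈ F) {f g : Allocation n → ℝ} (h : ∀ x ∈ F, f x ≤ g x) :
    expect μ f ≤ expect μ g := by
  rw [expect_eq_sum hμ, expect_eq_sum hμ]
  exact Finset.sum_le_sum fun x hx => mul_le_mul_of_nonneg_left (h x hx) ENNReal.toReal_nonneg

open Classical in
/-- The profile in which the agents of `S` have the value `1`, the others the value `ℓ`. -/
noncomputable def highProfile {n : ℕ} (ℓ : ℝ) (S : Set (Fin n)) :
    Profile (fun _ : Fin n => ({ℓ, 1} : Set ℝ)) :=
  fun i => if i ∈ S then ⟨1, by simp⟩ else ⟨ℓ, by simp⟩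

theorem highProfile_of_mem {n : ℕ} {ℓ : ℝ} {S : Set (Fin n)} {i : Fin n} (h : i ∈ S) :
    (highProfile ℓ S i : ℝ) = 1 := by
  simp [highProfile, h]

theorem highProfile_of_notMem {n : ℕ} {ℓ : ℝ} {S : Set (Fin n)} {i : Fin n} (h : i ∉ S) :
    (highProfile ℓ S i : ℝ) = ℓ := by
  simp [highProfile, h]

theorem highProfile_insert {n : ℕ} (ℓ : ℝ) (S : Set (Fin n)) (i : Fin n) :
    highProfile ℓ (insert i S) = Function.update (highProfile ℓ S) i ⟨1, by simp⟩ := by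
  funext j
  by_cases h : j = i
  · subst h; simp [highProfile]
  · by_cases hj : j ∈ S <;> simp [highProfile, h, hj]

/-- Truthfulness in expectation makes the expected allocation of an agent monotone in its value. -/
theorem Algorithm.IsTIE.expect_le {n : ℕ} {ℓ : ℝ} (hℓ : ℓ < 1)
    {B : Algorithm (fun _ : Fin n => ({ℓ, 1} : Set ℝ))} (hB : B.IsTIE)
    {F : Finset (Allocation n)} (hF : B.IsFor F) (S : Set (Fin n)) {i : Fin n} (hi : i ∉ S) :
    expect (B (highProfile ℓ S)) (fun x => x i) ≤
      expect (B (highProfile ℓ (insert i S))) (fun x => x i) := by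
  obtain ⟨pay, hpay⟩ := hB
  have hF' : ∀ v, ∀ x ∈ (B v).support, x ∈ F := fun v x hx => by simpa using hF v x hx
  have h1 := hpay i (highProfile ℓ S) ⟨1, by simp⟩
  have h2 := hpay i (highProfile ℓ (insert i S)) ⟨ℓ, by simp⟩
  have h3 : Function.update (highProfile ℓ (insert i S)) i ⟨ℓ, by simp⟩ = highProfile ℓ S := by
    funext j
    by_cases h : j = i
    · subst h; simp [highProfile, hi]
    · by_cases hj : j ∈ S <;> simp [highProfile, h, hj]
  rw [← highProfile_insert, expect_mul_sub (hF' _), expect_mul_sub (hF' _),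
    highProfile_of_notMem hi] at h1
  rw [h3, expect_mul_sub (hF' _), expect_mul_sub (hF' _),
    highProfile_of_mem (Set.mem_insert _ _)] at h2
  -- In the sum of `h1` and `h2` the payments cancel, leaving `1 - ℓ > 0` times the difference of
  -- the two expectations.
  nlinarith

/-- If all feasible allocations are constant on a set of agents, the common expected allocation
grows when agents of that set raise their values. -/
theorem Algorithm.IsTIE.expect_le_union {n : ℕ} {ℓ : ℝ} (hℓ : ℓ < 1)
    {B : Algorithm (fun _ : Fin n => ({ℓ, 1} : Set ℝ))} (hB : B.IsTIE)
    {F : Finset (Allocation n)} (hF : B.IsFor F) (h : Allocation n → ℝ) (S : Set (Fin n))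
    (W : Finset (Fin n)) (hW : ∀ x ∈ F, ∀ i ∈ W, x i = h x) :
    expect (B (highProfile ℓ S)) h ≤ expect (B (highProfile ℓ (S ∪ W))) h := by
  classical
  have hF' : ∀ v, ∀ x ∈ (B v).support, x ∈ F := fun v x hx => by simpa using hF v x hx
  -- Agents are raised one at a time: truthfulness speaks of the raised agent's own amount, which is
  -- `h` on the whole menu. Agents already in `S` change nothing.
  induction W using Finset.induction_on with
  | empty => simp
  | insert i W _ ih =>
    refine (ih fun x hx j hj => hW x hx j (Finset.mem_insert_of_mem hj)).trans ?_
    have heq : S ∪ ((insert i W : Finset (Fin n)) : Set (Fin n)) = insert i (S ∪ W) := by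
      ext j; simp
    rw [heq]
    by_cases hi : i ∈ S ∪ (W : Set (Fin n))
    · rw [Set.insert_eq_of_mem hi]
    · have hc : ∀ x ∈ F, h x = x i := fun x hx => (hW x hx i (Finset.mem_insert_self _ _)).symm
      calc _ ≤ expect (B (highProfile ℓ (S ∪ W))) (fun x => x i) :=
            expect_mono (hF' _) fun x hx => (hc x hx).le
        _ ≤ expect (B (highProfile ℓ (insert i (S ∪ W)))) (fun x => x i) :=
            hB.expect_le hℓ hF _ hi
        _ ≤ _ := expect_mono (hF' _) fun x hx => (hc x hx).ge

/-! ### Exponential tail bounds in counting form -/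

/-- Markov's inequality for a product of independent nonnegative variables, in counting form. -/
theorem card_le_prod_mul_le {J M : Type*} [Fintype J] [DecidableEq J] [Fintype M]
    (φ : J → M → ℝ) (hφ : ∀ j x, 0 ≤ φ j x) (c : J → ℝ)
    (hc : ∀ j, ∑ x, φ j x ≤ Fintype.card M * c j) (τ : ℝ) (s : Finset (J → M))
    (hs : ∀ m ∈ s, τ ≤ ∏ j, φ j (m j)) :
    (s.card : ℝ) * τ ≤ Fintype.card (J → M) * ∏ j, c j := by
  calc (s.card : ℝ) * τ = ∑ _m ∈ s, τ := by simp
    _ ≤ ∑ m ∈ s, ∏ j, φ j (m j) := Finset.sum_le_sum hs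
    _ ≤ ∑ m : J → M, ∏ j, φ j (m j) :=
        Finset.sum_le_univ_sum_of_nonneg fun m => Finset.prod_nonneg fun j _ => hφ _ _
    _ = ∏ j, ∑ x, φ j x := by rw [Finset.prod_univ_sum, Fintype.piFinset_univ]
    _ ≤ ∏ j, (Fintype.card M * c j) :=
        Finset.prod_le_prod (fun j _ => Finset.sum_nonneg fun x _ => hφ _ _) fun j _ => hc j
    _ = _ := by simp [Finset.prod_mul_distrib]

open Classical in
/-- The number of coordinates at which `m` satisfies `q`. -/
noncomputable def hits {J M : Type*} [Fintype J] (q : J → M → Prop) (m : J → M) : ℝ :=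
  ∑ j, if q j (m j) then 1 else 0

open Classical in
/-- The mean of `hits q`. -/
noncomputable def meanHits {J M : Type*} [Fintype J] [Fintype M] (q : J → M → Prop) : ℝ :=
  ∑ j, (∑ x, if q j x then 1 else 0) / (Fintype.card M : ℝ)

theorem meanHits_nonneg {J M : Type*} [Fintype J] [Fintype M] (q : J → M → Prop) :
    0 ≤ meanHits q := by
  unfold meanHits
  positivity

/-- Chernoff: an indicator of mean `p` has exponential moment `1 + (exp θ - 1) * p ≤ exp ((exp θ -
1) * p)`. The sign of `θ` is free, so both tails follow. -/
theorem card_hits_exp_le {J M : Type*} [Fintype J] [DecidableEq J] [Fintype M] [Nonempty M]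
    (q : J → M → Prop) (θ τ : ℝ) (s : Finset (J → M)) (hs : ∀ m ∈ s, τ ≤ θ * hits q m) :
    (s.card : ℝ) ≤
      Fintype.card (J → M) * Real.exp ((Real.exp θ - 1) * meanHits q - τ) := by
  classical
  have hM : (0 : ℝ) < Fintype.card M := by exact_mod_cast Fintype.card_pos
  have key := card_le_prod_mul_le (J := J) (M := M)
    (fun j x => Real.exp (θ * if q j x then 1 else 0)) (fun _ _ => (Real.exp_pos _).le)
    (fun j => Real.exp ((Real.exp θ - 1) *
      ((∑ x, if q j x then 1 else 0) / (Fintype.card M : ℝ)))) ?_ (Real.exp τ) s ?_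
  · rw [← Real.exp_sum, ← Finset.mul_sum] at key
    rw [Real.exp_sub, ← mul_div_assoc, le_div_iff₀ (Real.exp_pos _)]
    exact key
  · intro j
    have h1 : ∑ x, Real.exp (θ * if q j x then 1 else 0) =
        Fintype.card M * ((Real.exp θ - 1) *
          ((∑ x, if q j x then 1 else 0) / (Fintype.card M : ℝ)) + 1) := by
      have : ∀ x, Real.exp (θ * if q j x then 1 else 0) =
          (Real.exp θ - 1) * (if q j x then 1 else 0) + 1 := by
        intro x; split_ifs <;> simp
      simp only [this, Finset.sum_add_distrib, ← Finset.mul_sum, Finset.sum_const,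
        Finset.card_univ, nsmul_eq_mul, mul_one]
      field_simp
    rw [h1]
    exact mul_le_mul_of_nonneg_left (Real.add_one_le_exp _) hM.le
  · intro m hm
    rw [← Real.exp_sum, ← Finset.mul_sum]
    exact Real.exp_le_exp.2 (hs m hm)

/-- The case `θ = 1`: since `e - 1 < 2`, the multiple of the mean is absorbed and only `L` remains.
-/
theorem card_hits_gt_le {J M : Type*} [Fintype J] [DecidableEq J] [Fintype M] [Nonempty M]
    (q : J → M → Prop) (L : ℝ) (s : Finset (J → M))
    (hs : ∀ m ∈ s, 2 * meanHits q + L < hits q m) :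
    (s.card : ℝ) ≤ Fintype.card (J → M) * Real.exp (-L) := by
  refine (card_hits_exp_le q 1 (2 * meanHits q + L) s fun m hm => by
    rw [one_mul]; exact (hs m hm).le).trans ?_
  gcongr
  have := Real.exp_one_lt_d9
  nlinarith [meanHits_nonneg q]

/-- The case `θ = -1`: since `1 - 1 / e ≥ 1 / 2 > 1 / 4`, again only `L` remains. -/
theorem card_hits_lt_le {J M : Type*} [Fintype J] [DecidableEq J] [Fintype M] [Nonempty M]
    (q : J → M → Prop) (L : ℝ) (s : Finset (J → M))
    (hs : ∀ m ∈ s, hits q m < meanHits q / 4 - L) :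
    (s.card : ℝ) ≤ Fintype.card (J → M) * Real.exp (-L) := by
  refine (card_hits_exp_le q (-1) (-(meanHits q / 4 - L)) s fun m hm => by
    have := hs m hm; linarith).trans ?_
  gcongr
  have h1 : Real.exp (-1) ≤ 1 / 2 := by
    rw [Real.exp_neg, ← one_div]
    exact one_div_le_one_div_of_le (by norm_num) (by linarith [Real.exp_one_gt_d9])
  nlinarith [meanHits_nonneg q]

/-- For independent fair coins choosing which of the two indicators in a pair goes to `X` and
which to `Y`, the event `2 * Y + L ≤ X` is rare. -/
theorem card_flip_le {J : Type*} [Fintype J] [DecidableEq J] (q : J → Bool → Prop) (L : ℕ)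
    (s : Finset (J → Bool))
    (hs : ∀ m ∈ s, 2 * hits q (fun j => !(m j)) + L ≤ hits q m) :
    (s.card : ℝ) ≤ Fintype.card (J → Bool) * (2 / 3) ^ L := by
  classical
  -- With base `3 / 2`, the moment of `X - 2 * Y` in one pair is `1` if neither indicator holds, `(3
  -- / 2 + 4 / 9) / 2 = 35 / 36` if exactly one does, and `2 / 3` if both do. It never exceeds `1`,
  -- so no mean enters the bound.
  set θ : ℝ := Real.log (3 / 2) with hθ
  have hθ0 : 0 < θ := Real.log_pos (by norm_num)
  have he : Real.exp θ = 3 / 2 := Real.exp_log (by norm_num)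
  have key := card_le_prod_mul_le (J := J) (M := Bool)
    (fun j x => Real.exp (θ * ((if q j x then 1 else 0) - 2 * if q j (!x) then 1 else 0)))
    (fun _ _ => (Real.exp_pos _).le) (fun _ => 1) ?_ (Real.exp (θ * L)) s ?_
  · rw [mul_comm θ, Real.exp_nat_mul, he, Finset.prod_const_one, mul_one] at key
    have h32 : ((2 : ℝ) / 3) ^ L = ((3 / 2 : ℝ) ^ L)⁻¹ := by rw [← inv_pow]; norm_num
    rw [h32, ← div_eq_mul_inv, le_div_iff₀ (by positivity)]
    exact key
  · intro j
    have h1 : Real.exp (θ * (1 - 2 * 0)) = 3 / 2 := by simpa using he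
    have h2 : Real.exp (θ * (0 - 2 * 1)) = 4 / 9 := by
      have : θ * (0 - 2 * 1) = -(θ + θ) := by ring
      rw [this, Real.exp_neg, Real.exp_add, he]; norm_num
    have h3 : Real.exp (θ * (1 - 2 * 1)) = 2 / 3 := by
      have : θ * (1 - 2 * 1) = -θ := by ring
      rw [this, Real.exp_neg, he]; norm_num
    have h4 : Real.exp (θ * (0 - 2 * 0)) = 1 := by simp
    by_cases ht : q j true <;> by_cases hf : q j false <;>
      simp only [Fintype.sum_bool, ht, hf, if_true, if_false, Bool.not_true, Bool.not_false,
        h1, h2, h3, h4, Fintype.card_bool] <;> norm_num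
  · intro m hm
    rw [← Real.exp_sum, ← Finset.mul_sum, Finset.sum_sub_distrib, ← Finset.mul_sum]
    refine Real.exp_le_exp.2 (mul_le_mul_of_nonneg_left ?_ hθ0.le)
    have := hs m hm
    unfold hits at this
    linarith

/-! ### Placements of slots and averaging over them -/

/-- The slots of a block of agents. The left slots form the broad part of the block; `inl none` and
`inr none` are the two distinguished slots. -/
abbrev Slot (P Q : Type) : Type := Option P ⊕ Option Q

/-- A placement of the slots of all blocks among the agents. -/
abbrev Placement (J P Q : Type) (n : ℕ) : Type := J × Slot P Q ↪ Fin n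

section Placement

variable {J P Q : Type} {n : ℕ}

/-- Permute the slots inside each block. -/
def twist (e : Placement J P Q n) (m : J → Equiv.Perm (Slot P Q)) : Placement J P Q n :=
  (Equiv.prodCongrRight m).toEmbedding.trans e

@[simp]
theorem twist_apply (e : Placement J P Q n) (m : J → Equiv.Perm (Slot P Q)) (j : J)
    (b : Slot P Q) : twist e m (j, b) = e (j, m j b) := rfl

/-- Permuting the slots by a fixed family is a bijection of placements. -/
def twistEquiv (m : J → Equiv.Perm (Slot P Q)) : Placement J P Q n ≃ Placement J P Q n where
  toFun e := twist e m
  invFun e := twist e fun j => (m j).symm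
  left_inv e := by ext ⟨j, b⟩; simp
  right_inv e := by ext ⟨j, b⟩; simp

/-- The allocation giving each agent the weight of its slot, and nothing to agents without one. -/
noncomputable def place (e : Placement J P Q n) (f : Slot P Q → ℝ) : Allocation n :=
  Function.extend e (fun p => f p.2) 0

theorem place_apply (e : Placement J P Q n) (f : Slot P Q → ℝ) (p : J × Slot P Q) :
    place e f (e p) = f p.2 :=
  e.injective.extend_apply _ _ _

theorem place_apply_of_notMem (e : Placement J P Q n) (f : Slot P Q → ℝ) {i : Fin n}
    (hi : i ∉ Set.range e) : place e f i = 0 :=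
  Function.extend_apply' _ _ _ hi

theorem place_le_place (e : Placement J P Q n) {f g : Slot P Q → ℝ} (h : ∀ b, f b ≤ g b)
    (i : Fin n) : place e f i ≤ place e g i := by
  by_cases hi : i ∈ Set.range e
  · obtain ⟨p, rfl⟩ := hi
    simpa only [place_apply] using h p.2
  · simp only [place_apply_of_notMem e _ hi, le_refl]

theorem place_nonneg (e : Placement J P Q n) {f : Slot P Q → ℝ} (h : ∀ b, 0 ≤ f b)
    (i : Fin n) : 0 ≤ place e f i := by
  by_cases hi : i ∈ Set.range e
  · obtain ⟨p, rfl⟩ := hi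
    simpa only [place_apply] using h p.2
  · simp only [place_apply_of_notMem e _ hi, le_refl]

theorem range_twist (e : Placement J P Q n) (m : J → Equiv.Perm (Slot P Q)) :
    Set.range (twist e m) = Set.range e := by
  ext i
  constructor
  · rintro ⟨⟨j, b⟩, rfl⟩
    exact ⟨_, rfl⟩
  · rintro ⟨⟨j, b⟩, rfl⟩
    exact ⟨(j, (m j).symm b), by simp⟩

/-- Weights invariant under the permutations cannot reveal them; this is what conceals a twist. -/
theorem place_twist (e : Placement J P Q n) (m : J → Equiv.Perm (Slot P Q))
    {f : Slot P Q → ℝ} (h : ∀ j b, f (m j b) = f b) : place (twist e m) f = place e f := by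
  funext i
  by_cases hi : i ∈ Set.range (twist e m)
  · obtain ⟨⟨j, b⟩, rfl⟩ := hi
    rw [place_apply, twist_apply, place_apply]
    exact (h j b).symm
  · rw [place_apply_of_notMem _ _ hi, place_apply_of_notMem]
    rwa [← range_twist e m]

/-- The agents placed at certain slots. -/
def slotSet (e : Placement J P Q n) (s : Set (Slot P Q)) : Set (Fin n) :=
  e '' {p | p.2 ∈ s}

theorem slotSet_twist (e : Placement J P Q n) (m : J → Equiv.Perm (Slot P Q))
    {s : Set (Slot P Q)} (h : ∀ j b, m j b ∈ s ↔ b ∈ s) :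
    slotSet (twist e m) s = slotSet e s := by
  ext i
  constructor
  · rintro ⟨⟨j, b⟩, hb, rfl⟩
    exact ⟨(j, m j b), (h j b).2 hb, rfl⟩
  · rintro ⟨⟨j, b⟩, hb, rfl⟩
    refine ⟨(j, (m j).symm b), ?_, by simp⟩
    have := h j ((m j).symm b)
    rw [Equiv.apply_symm_apply] at this
    exact this.1 hb

theorem sum_place [Fintype J] [Fintype P] [Fintype Q] (e : Placement J P Q n)
    (f : Slot P Q → ℝ) (v : Fin n → ℝ) :
    ∑ i, v i * place e f i = ∑ j, ∑ b, v (e (j, b)) * f b := by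
  classical
  calc ∑ i, v i * place e f i = ∑ i ∈ Finset.univ.map e, v i * place e f i := by
        refine (Finset.sum_subset (Finset.subset_univ _) fun i _ hi => ?_).symm
        rw [place_apply_of_notMem, mul_zero]
        rintro ⟨p, rfl⟩
        exact hi (Finset.mem_map_of_mem _ (Finset.mem_univ _))
    _ = ∑ p, v (e p) * f p.2 := by
        rw [Finset.sum_map]
        simp only [place_apply]
    _ = _ := Fintype.sum_prod_type _

/-- A bound for the average over all families of permutations of a certain kind yields a bound for
the average over all placements. -/
theorem sum_placement_le {M : Type*} [Fintype M] [Nonempty M] [Fintype (Placement J P Q n)]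
    (π : M → J → Equiv.Perm (Slot P Q)) (g : Placement J P Q n → ℝ≥0∞) (C : ℝ≥0∞)
    (h : ∀ e, ∑ m, g (twist e (π m)) ≤ Fintype.card M * C) :
    ∑ e, g e ≤ Fintype.card (Placement J P Q n) * C := by
  have h1 : (Fintype.card M : ℝ≥0∞) * ∑ e, g e ≤
      Fintype.card M * (Fintype.card (Placement J P Q n) * C) := by
    -- For each fixed `m` twisting is a bijection of placements, so it only reindexes the sum; the
    -- family `π` need not be a group.
    calc (Fintype.card M : ℝ≥0∞) * ∑ e, g e = ∑ _m : M, ∑ e, g e := by simp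
      _ = ∑ m : M, ∑ e, g (twist e (π m)) :=
          Finset.sum_congr rfl fun m _ => ((twistEquiv (π m)).sum_comp g).symm
      _ = ∑ e, ∑ m, g (twist e (π m)) := Finset.sum_comm
      _ ≤ ∑ _e : Placement J P Q n, Fintype.card M * C := Finset.sum_le_sum fun e _ => h e
      _ = _ := by simp; ring
  refine (ENNReal.mul_le_mul_iff_right ?_ (ENNReal.natCast_ne_top _)).1 h1
  simp

end Placement

/-! ### The three allocations and the algorithm -/

/-- Weights of the sharp allocation. -/
def sharpWeight {P Q : Type} (α : ℝ) : Slot P Q → ℝ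
  | .inl none => 1
  | .inl (some _) => α
  | .inr none => 1
  | .inr (some _) => 0

/-- Weights of the broad allocation. -/
def broadWeight {P Q : Type} (α : ℝ) : Slot P Q → ℝ
  | .inl _ => α
  | .inr _ => 0

section Rule

variable {J P Q : Type} {n : ℕ}

/-- The allocation that is large on the two distinguished slots of each block. -/
noncomputable def sharp (e : Placement J P Q n) (α : ℝ) : Allocation n := place e (sharpWeight α)

/-- The allocation that is constant on the left slots. -/
noncomputable def broad (e : Placement J P Q n) (α : ℝ) : Allocation n := place e (broadWeight α)

/-- The allocation that treats all agents alike. -/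
def flat (n : ℕ) (γ : ℝ) : Allocation n := fun _ => γ

/-- The number of blocks whose slot `b` is occupied by an agent of value `1`. -/
noncomputable def highCount [Fintype J] {D : Fin n → Set ℝ} (e : Placement J P Q n) (b : Slot P Q)
    (v : Profile D) : ℝ :=
  hits (fun j b => (v (e (j, b)) : ℝ) = 1) (fun _ => b)

open Classical in
/-- Return `y`, unless `x` is better by a factor of more than `6`. -/
noncomputable def prefer {D : Fin n → Set ℝ} (x y : Allocation n) (v : Profile D) : Allocation n :=
  if welfare x v ≤ 6 * welfare y v then y else x

open Classical in
/-- The algorithm returns a sixth-optimal one of the flat, the broad and the sharp allocation. -/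
noncomputable def mixedRule [Fintype J] {D : Fin n → Set ℝ} (e : Placement J P Q n) (α γ : ℝ)
    (L : ℕ) : DetAlgorithm D := fun v =>
  prefer (sharp e α)
    -- This test separates the two concealments: random exchanges of left and right distinguished
    -- slots make it fail, while for random positions within each side it almost always holds when
    -- broad beats flat.
    (if 2 * highCount e (.inr none) v + L ≤ highCount e (.inl none) v ∧
        welfare (flat n γ) v < welfare (broad e α) v
      then broad e α else flat n γ) v

/-- The feasible allocations. -/
noncomputable def menu (e : Placement J P Q n) (α γ : ℝ) : Finset (Allocation n) := by
  classical exact {flat n γ, broad e α, sharp e α}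

theorem mem_menu {e : Placement J P Q n} {α γ : ℝ} {x : Allocation n} :
    x ∈ menu e α γ ↔ x = flat n γ ∨ x = broad e α ∨ x = sharp e α := by
  simp [menu]

theorem mixedRule_mem [Fintype J] {D : Fin n → Set ℝ} (e : Placement J P Q n) (α γ : ℝ) (L : ℕ)
    (v : Profile D) : mixedRule e α γ L v ∈ menu e α γ := by
  rw [mem_menu]
  unfold mixedRule prefer
  split_ifs <;> simp

theorem broadWeight_le {α : ℝ} (hα : α ≤ 1) (b : Slot P Q) :
    broadWeight α b ≤ sharpWeight α b := by
  rcases b with (_ | _) | (_ | _) <;> simp [broadWeight, sharpWeight, hα]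

theorem sharpWeight_nonneg {α : ℝ} (hα : 0 ≤ α) (b : Slot P Q) : 0 ≤ sharpWeight α b := by
  rcases b with (_ | _) | (_ | _) <;> simp [sharpWeight, hα]

theorem broadWeight_nonneg {α : ℝ} (hα : 0 ≤ α) (b : Slot P Q) : 0 ≤ broadWeight α b := by
  rcases b with _ | _ <;> simp [broadWeight, hα]

theorem sharp_ne_flat [Nonempty J] (e : Placement J P Q n) {α γ : ℝ} (hγ : γ < 1) :
    sharp e α ≠ flat n γ := by
  intro h
  have := congrFun h (e (Classical.arbitrary J, .inl none))
  rw [sharp, place_apply] at this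
  exact hγ.ne' this

theorem sharp_ne_broad [Nonempty J] (e : Placement J P Q n) {α : ℝ} (hα : α < 1) :
    sharp e α ≠ broad e α := by
  intro h
  have := congrFun h (e (Classical.arbitrary J, .inl none))
  rw [sharp, broad, place_apply, place_apply] at this
  exact hα.ne' this

theorem broad_ne_flat [Nonempty J] (e : Placement J P Q n) {α γ : ℝ} (h : γ ≠ α) :
    broad e α ≠ flat n γ := by
  intro h'
  have := congrFun h' (e (Classical.arbitrary J, .inl none))
  rw [broad, place_apply] at this
  exact h this.symm

theorem menu_nonneg (e : Placement J P Q n) {α γ : ℝ} (hα : 0 ≤ α) (hγ : 0 ≤ γ)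
    {x : Allocation n} (hx : x ∈ menu e α γ) (i : Fin n) : 0 ≤ x i := by
  rcases mem_menu.1 hx with rfl | rfl | rfl
  · exact hγ
  · exact place_nonneg e (broadWeight_nonneg hα) i
  · exact place_nonneg e (sharpWeight_nonneg hα) i

/-- The slots of the broad part that are not distinguished. -/
def innerSlots (P Q : Type) : Set (Slot P Q) := {b | ∃ x, b = .inl (some x)}

/-- The slots of the broad part. -/
def broadSlots (P Q : Type) : Set (Slot P Q) := {b | ∃ x, b = .inl x}

theorem slotSet_broadSlots [Fintype J] [DecidableEq (Fin n)] (e : Placement J P Q n) :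
    slotSet e (broadSlots P Q) = slotSet e (innerSlots P Q) ∪
      (Finset.univ.image (fun j : J => e (j, .inl none)) : Finset (Fin n)) := by
  ext i
  simp only [slotSet, broadSlots, innerSlots, Set.mem_union, Set.mem_image, Set.mem_ofPred_eq,
    Finset.coe_image, Finset.coe_univ, Set.image_univ, Set.mem_range]
  constructor
  · rintro ⟨⟨j, b⟩, ⟨x, hx⟩, rfl⟩
    simp only at hx
    subst hx
    rcases x with _ | x
    · exact Or.inr ⟨j, rfl⟩
    · exact Or.inl ⟨(j, _), ⟨x, rfl⟩, rfl⟩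
  · rintro (⟨⟨j, b⟩, ⟨x, hx⟩, rfl⟩ | ⟨j, rfl⟩)
    · exact ⟨(j, b), ⟨some x, hx⟩, rfl⟩
    · exact ⟨(j, _), ⟨none, rfl⟩, rfl⟩

end Rule

/-! ### Welfare estimates -/

section Welfare

variable {J P Q : Type} [Fintype J] [Fintype P] [Fintype Q] {n : ℕ} {ℓ : ℝ}

theorem value_eq (v : Profile (fun _ : Fin n => ({ℓ, 1} : Set ℝ))) (i : Fin n) :
    (v i : ℝ) = ℓ ∨ (v i : ℝ) = 1 := (v i).2

theorem value_pos (hℓ : 0 < ℓ) (v : Profile (fun _ : Fin n => ({ℓ, 1} : Set ℝ))) (i : Fin n) :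
    0 < (v i : ℝ) := by
  rcases value_eq v i with h | h <;> rw [h] <;> linarith

open Classical in
theorem value_le (hℓ : 0 < ℓ) (v : Profile (fun _ : Fin n => ({ℓ, 1} : Set ℝ))) (i : Fin n) :
    (v i : ℝ) ≤ (if (v i : ℝ) = 1 then 1 else 0) + ℓ := by
  rcases value_eq v i with h | h <;> split_ifs <;> linarith

open Classical in
theorem le_value (hℓ : 0 < ℓ) (v : Profile (fun _ : Fin n => ({ℓ, 1} : Set ℝ))) (i : Fin n) :
    (if (v i : ℝ) = 1 then 1 else 0) ≤ (v i : ℝ) := by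
  rcases value_eq v i with h | h <;> split_ifs <;> linarith

open Classical in
theorem le_value' (hℓ' : ℓ ≤ 1 / 2)
    (v : Profile (fun _ : Fin n => ({ℓ, 1} : Set ℝ))) (i : Fin n) :
    ℓ + (if (v i : ℝ) = 1 then 1 else 0) / 2 ≤ (v i : ℝ) := by
  rcases value_eq v i with h | h <;> split_ifs <;> linarith

theorem welfare_pos (hℓ : 0 < ℓ) (v : Profile (fun _ : Fin n => ({ℓ, 1} : Set ℝ)))
    {x : Allocation n} (hx : ∀ i, 0 ≤ x i) {i : Fin n} (hi : 0 < x i) : 0 < welfare x v :=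
  Finset.sum_pos' (fun i _ => mul_nonneg (value_pos hℓ v i).le (hx i))
    ⟨i, Finset.mem_univ _, mul_pos (value_pos hℓ v i) hi⟩

theorem welfare_mono (hℓ : 0 < ℓ) (v : Profile (fun _ : Fin n => ({ℓ, 1} : Set ℝ)))
    {x y : Allocation n} (h : ∀ i, x i ≤ y i) : welfare x v ≤ welfare y v :=
  Finset.sum_le_sum fun i _ => mul_le_mul_of_nonneg_left (h i) (value_pos hℓ v i).le

theorem welfare_broad (e : Placement J P Q n) (α : ℝ) {D : Fin n → Set ℝ} (v : Profile D) :
    welfare (broad e α) v = α * ∑ j, ∑ i, (v (e (j, .inl i)) : ℝ) := by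
  unfold welfare broad
  rw [sum_place e _ (fun i => (v i : ℝ)), Finset.mul_sum]
  refine Finset.sum_congr rfl fun j _ => ?_
  rw [Fintype.sum_sum_type, Finset.mul_sum]
  simp [broadWeight, mul_comm]

theorem welfare_sharp (e : Placement J P Q n) (α : ℝ) {D : Fin n → Set ℝ} (v : Profile D) :
    welfare (sharp e α) v = ∑ j, (v (e (j, .inl none)) : ℝ) + ∑ j, (v (e (j, .inr none)) : ℝ)
      + α * ∑ j, ∑ i : P, (v (e (j, .inl (some i))) : ℝ) := by
  unfold welfare sharp
  rw [sum_place e _ (fun i => (v i : ℝ)), Finset.mul_sum, ← Finset.sum_add_distrib,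
    ← Finset.sum_add_distrib]
  refine Finset.sum_congr rfl fun j _ => ?_
  rw [Fintype.sum_sum_type, Finset.mul_sum, Fintype.sum_option, Fintype.sum_option]
  simp [sharpWeight, mul_comm]
  ring

theorem welfare_sharp_le (hℓ : 0 < ℓ) {α : ℝ} (hα : 0 ≤ α) (e : Placement J P Q n)
    (v : Profile (fun _ : Fin n => ({ℓ, 1} : Set ℝ))) :
    welfare (sharp e α) v ≤ highCount e (.inl none) v + highCount e (.inr none) v
      + 2 * (ℓ * Fintype.card J) + welfare (broad e α) v := by
  have h1 : ∀ b : Slot P Q, ∑ j, (v (e (j, b)) : ℝ) ≤ highCount e b v + ℓ * Fintype.card J := by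
    intro b
    calc ∑ j, (v (e (j, b)) : ℝ) ≤ _ := Finset.sum_le_sum fun j _ => value_le hℓ v (e (j, b))
      _ = _ := by
        rw [Finset.sum_add_distrib]
        simp [highCount, hits, mul_comm]
  rw [welfare_sharp, welfare_broad]
  have h2 : ∑ j, ∑ i : P, (v (e (j, .inl (some i))) : ℝ) ≤ ∑ j, ∑ i, (v (e (j, .inl i)) : ℝ) := by
    refine Finset.sum_le_sum fun j _ => ?_
    rw [Fintype.sum_option]
    linarith [value_pos hℓ v (e (j, .inl none))]
  have h3 := mul_le_mul_of_nonneg_left h2 hα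
  linarith [h1 (.inl none), h1 (.inr none)]

-- Flat must outweigh both the low values and the high values on the right, as these contribute to
-- sharp but not to broad. The factor `1 / 2` comes from `ℓ + 1 / 2 ≤ 1`.
open Classical in
theorem welfare_flat_ge (hℓ' : ℓ ≤ 1 / 2) {γ : ℝ} (hγ : 0 ≤ γ)
    (e : Placement J P Q n) (v : Profile (fun _ : Fin n => ({ℓ, 1} : Set ℝ))) :
    γ * (ℓ * n + (∑ j, ∑ k, if (v (e (j, .inr k)) : ℝ) = 1 then 1 else 0) / 2) ≤
      welfare (flat n γ) v := by
  have h0 : welfare (flat n γ) v = γ * ∑ i, (v i : ℝ) := by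
    simp [welfare, flat, Finset.mul_sum, mul_comm]
  rw [h0]
  refine mul_le_mul_of_nonneg_left ?_ hγ
  calc ℓ * n + (∑ j, ∑ k, if (v (e (j, .inr k)) : ℝ) = 1 then (1 : ℝ) else 0) / 2
      ≤ ℓ * n + (∑ i, if (v i : ℝ) = 1 then (1 : ℝ) else 0) / 2 := by
        gcongr
        have h1 := sum_place e (fun b => Sum.elim (fun _ => 0) (fun _ => 1) b)
          (fun i => if (v i : ℝ) = 1 then (1 : ℝ) else 0)
        have h2 : ∑ j, ∑ k, (if (v (e (j, .inr k)) : ℝ) = 1 then (1 : ℝ) else 0) =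
            ∑ i, (if (v i : ℝ) = 1 then (1 : ℝ) else 0) *
              place e (fun b => Sum.elim (fun _ => 0) (fun _ => 1) b) i := by
          rw [h1]
          simp [Fintype.sum_sum_type]
        rw [h2]
        refine Finset.sum_le_sum fun i _ => mul_le_of_le_one_right (by split_ifs <;> simp) ?_
        by_cases hi : i ∈ Set.range e
        · obtain ⟨⟨j, b⟩, rfl⟩ := hi
          rw [place_apply]
          rcases b with _ | _ <;> simp
        · rw [place_apply_of_notMem _ _ hi]; simp
    _ = ∑ i, (ℓ + (if (v i : ℝ) = 1 then 1 else 0) / 2) := by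
        rw [Finset.sum_add_distrib, Finset.sum_div]
        simp [mul_comm]
    _ ≤ _ := Finset.sum_le_sum fun i _ => le_value' hℓ' v i

end Welfare

theorem welfare_menu_pos {J P Q : Type} {n : ℕ} {ℓ : ℝ} [Nonempty J] (hℓ : 0 < ℓ) (e : Placement J P Q n) {α γ : ℝ}
    (hα : 0 < α) (hγ : 0 < γ) (v : Profile (fun _ : Fin n => ({ℓ, 1} : Set ℝ)))
    {x : Allocation n} (hx : x ∈ menu e α γ) : 0 < welfare x v := by
  refine welfare_pos hℓ v (menu_nonneg e hα.le hγ.le hx)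
    (i := e (Classical.arbitrary J, .inl none)) ?_
  rcases mem_menu.1 hx with rfl | rfl | rfl
  · exact hγ
  · simpa [broad, place_apply, broadWeight] using hα
  · simp [sharp, place_apply, sharpWeight]

/-! ### Optimal welfare and approximation ratios -/

theorem expect_pure {n : ℕ} (y : Allocation n) (f : Allocation n → ℝ) :
    expect (PMF.pure y) f = f y := by
  rw [expect_eq_sum (F := {y}) (by simp)]
  simp

theorem le_opt {D : Fin n → Set ℝ} (F : Finset (Allocation n)) (v : Profile D)
    {x : Allocation n} (hx : x ∈ F) : welfare x v ≤ opt (F : Set (Allocation n)) v :=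
  le_csSup (F.finite_toSet.image _).bddAbove (Set.mem_image_of_mem _ hx)

/-- Broad lies below sharp pointwise, so the optimum is flat or sharp. The alternative offered to
`prefer` is never worse than flat, and `prefer` loses at most a factor `6` against sharp. -/
theorem opt_menu_le {J P Q : Type} [Fintype J] {n : ℕ} {ℓ : ℝ} [Nonempty J] (hℓ : 0 < ℓ) (e : Placement J P Q n) {α γ : ℝ} (hα : 0 < α)
    (hα' : α ≤ 1) (hγ : 0 < γ) (L : ℕ) (v : Profile (fun _ : Fin n => ({ℓ, 1} : Set ℝ))) :
    opt (menu e α γ : Set (Allocation n)) v ≤ 6 * welfare (mixedRule e α γ L v) v := by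
  refine csSup_le (Set.Nonempty.image _ ⟨_, mem_menu.2 (Or.inl rfl)⟩) ?_
  rintro _ ⟨x, hx, rfl⟩
  have h0 := welfare_menu_pos hℓ e hα hγ v (x := flat n γ) (mem_menu.2 (Or.inl rfl))
  have h1 : welfare (broad e α) v ≤ welfare (sharp e α) v :=
    welfare_mono hℓ v (place_le_place e (broadWeight_le hα'))
  have h2 := welfare_menu_pos hℓ e hα hγ v (x := broad e α) (mem_menu.2 (by simp))
  have h3 : welfare x v ≤ welfare (flat n γ) v ∨ welfare x v ≤ welfare (sharp e α) v := by
    rcases mem_menu.1 hx with rfl | rfl | rfl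
    · exact Or.inl le_rfl
    · exact Or.inr h1
    · exact Or.inr le_rfl
  dsimp only
  unfold mixedRule prefer
  split_ifs with hC hp hp
  · rcases h3 with h | h <;> linarith [hC.2]
  · rcases h3 with h | h <;> linarith [hC.2]
  · rcases h3 with h | h <;> linarith
  · rcases h3 with h | h <;> linarith

theorem opt_menu_pos {J P Q : Type} {n : ℕ} {ℓ : ℝ} [Nonempty J] (hℓ : 0 < ℓ) (e : Placement J P Q n) {α γ : ℝ}
    (hα : 0 < α) (hγ : 0 < γ) (v : Profile (fun _ : Fin n => ({ℓ, 1} : Set ℝ))) :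
    0 < opt (menu e α γ : Set (Allocation n)) v :=
  (welfare_menu_pos hℓ e hα hγ v (mem_menu.2 (Or.inl rfl))).trans_le
    (le_opt _ v (mem_menu.2 (Or.inl rfl)))

section Approx

variable {J P Q : Type} {n : ℕ} {ℓ : ℝ}

theorem one_sixth_le_approx_mixedRule [Fintype J] [Nonempty J] (hℓ : 0 < ℓ) (e : Placement J P Q n) {α γ : ℝ}
    (hα : 0 < α) (hα' : α ≤ 1) (hγ : 0 < γ) (L : ℕ) :
    1 / 6 ≤ approx (menu e α γ : Set (Allocation n)) (DetAlgorithm.toAlgorithm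
      (mixedRule (D := fun _ : Fin n => ({ℓ, 1} : Set ℝ)) e α γ L)) := by
  have : Nonempty (Profile (fun _ : Fin n => ({ℓ, 1} : Set ℝ))) := ⟨highProfile ℓ ∅⟩
  refine le_ciInf fun v => ?_
  rw [DetAlgorithm.toAlgorithm, expect_pure, le_div_iff₀]
  · linarith [opt_menu_le hℓ e hα hα' hγ L v]
  · exact (welfare_menu_pos hℓ e hα hγ v (mem_menu.2 (Or.inl rfl))).trans_le
      (le_opt _ v (mem_menu.2 (Or.inl rfl)))

/-- The final ratio has this quantity as denominator. There are finitely many profiles, so the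
infimum is attained, and every allocation in the menu has positive welfare. -/
theorem approx_pos [Nonempty J] (hℓ : 0 < ℓ) (e : Placement J P Q n) {α γ : ℝ} (hα : 0 < α)
    (hγ : 0 < γ) {B : Algorithm (fun _ : Fin n => ({ℓ, 1} : Set ℝ))}
    (hB : B.IsFor (menu e α γ : Set (Allocation n))) :
    0 < approx (menu e α γ : Set (Allocation n)) B := by
  have : Nonempty (Profile (fun _ : Fin n => ({ℓ, 1} : Set ℝ))) := ⟨highProfile ℓ ∅⟩
  obtain ⟨v, hv⟩ := exists_eq_ciInf_of_finite
    (f := fun v => expect (B v) (fun x => welfare x v) / opt (menu e α γ : Set (Allocation n)) v)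
  rw [approx, ← hv]
  refine div_pos ?_ (opt_menu_pos hℓ e hα hγ v)
  have hB' : ∀ x ∈ (B v).support, x ∈ menu e α γ := fun x hx => by simpa using hB v x hx
  rw [expect_eq_sum hB']
  refine Finset.sum_pos' (fun x hx => mul_nonneg ENNReal.toReal_nonneg
    (welfare_menu_pos hℓ e hα hγ v hx).le) ?_
  obtain ⟨x, hx⟩ := (B v).support_nonempty
  refine ⟨x, hB' x hx, mul_pos (ENNReal.toReal_pos ?_ (PMF.apply_ne_top _ _))
    (welfare_menu_pos hℓ e hα hγ v (hB' x hx))⟩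
  exact (PMF.mem_support_iff _ _).1 hx

theorem approx_le [Nonempty J] (hℓ : 0 < ℓ) (e : Placement J P Q n) {α γ : ℝ} (hα : 0 < α)
    (hγ : 0 < γ) {B : Algorithm (fun _ : Fin n => ({ℓ, 1} : Set ℝ))}
    (hB : B.IsFor (menu e α γ : Set (Allocation n)))
    (v : Profile (fun _ : Fin n => ({ℓ, 1} : Set ℝ))) :
    approx (menu e α γ : Set (Allocation n)) B ≤
      expect (B v) (fun x => welfare x v) / opt (menu e α γ : Set (Allocation n)) v := by
  refine ciInf_le ⟨0, ?_⟩ v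
  rintro _ ⟨v, rfl⟩
  have hB' : ∀ x ∈ (B v).support, x ∈ menu e α γ := fun x hx => by simpa using hB v x hx
  dsimp only
  rw [expect_eq_sum hB']
  exact div_nonneg (Finset.sum_nonneg fun x hx => mul_nonneg ENNReal.toReal_nonneg
    (welfare_menu_pos hℓ e hα hγ v hx).le) (opt_menu_pos hℓ e hα hγ v).le

/-- At the profile of the inner slots, the sharp allocation is much better than the flat one. -/
theorem flat_le_sharp [Fintype J] [Fintype P] [Fintype Q] (hℓ : 0 < ℓ) (e : Placement J P Q n) {α γ : ℝ}
    (hα : 0 < α) (hγ : 0 < γ) (hn : ℓ * n ≤ Fintype.card J * Fintype.card P) :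
    welfare (flat n γ) (highProfile ℓ (slotSet e (innerSlots P Q))) ≤
      2 * γ / α * welfare (sharp e α) (highProfile ℓ (slotSet e (innerSlots P Q))) := by
  classical
  set v := highProfile ℓ (slotSet e (innerSlots P Q)) with hv
  have hin : ∀ j (i : P), (v (e (j, .inl (some i))) : ℝ) = 1 := fun j i =>
    highProfile_of_mem ⟨_, ⟨i, rfl⟩, rfl⟩
  have h1 : α * (Fintype.card J * Fintype.card P) ≤ welfare (sharp e α) v := by
    rw [welfare_sharp]
    simp only [hin]
    have : 0 ≤ ∑ j, (v (e (j, .inl none)) : ℝ) + ∑ j, (v (e (j, .inr none)) : ℝ) :=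
      add_nonneg (Finset.sum_nonneg fun j _ => (value_pos hℓ v _).le)
        (Finset.sum_nonneg fun j _ => (value_pos hℓ v _).le)
    simpa using this
  -- By `hn` the low values together add no more than the high agents do, whence the factor `2` in
  -- the conclusion.
  have h2 : ∑ i, (v i : ℝ) ≤ Fintype.card J * Fintype.card P + ℓ * n := by
    have h3 : ∀ i, (v i : ℝ) ≤
        1 * place e (fun b => if b ∈ innerSlots P Q then 1 else 0) i + ℓ := by
      intro i
      by_cases hi : i ∈ slotSet e (innerSlots P Q)
      · have hi' := hi
        obtain ⟨p, hp, rfl⟩ := hi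
        rw [hv, highProfile_of_mem hi', place_apply, if_pos (show p.2 ∈ innerSlots P Q from hp)]
        linarith
      · rw [hv, highProfile_of_notMem hi]
        have := place_nonneg e (f := fun b => if b ∈ innerSlots P Q then 1 else 0)
          (fun b => by split_ifs <;> simp) i
        linarith
    refine (Finset.sum_le_sum fun i _ => h3 i).trans ?_
    rw [Finset.sum_add_distrib, sum_place e _ (fun _ => 1)]
    have h4 : ∑ b, (if b ∈ innerSlots P Q then (1 : ℝ) else 0) = Fintype.card P := by
      have hl : (Sum.inl none : Slot P Q) ∉ innerSlots P Q := by simp [innerSlots]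
      have hs : ∀ x : P, (Sum.inl (some x) : Slot P Q) ∈ innerSlots P Q := fun x => ⟨x, rfl⟩
      have hr : ∀ x, (Sum.inr x : Slot P Q) ∉ innerSlots P Q := by simp [innerSlots]
      rw [Fintype.sum_sum_type, Fintype.sum_option]
      simp [hl, hs, hr]
    simp only [one_mul, h4]
    simp [mul_comm]
  have h0 : welfare (flat n γ) v = γ * ∑ i, (v i : ℝ) := by
    simp [welfare, flat, Finset.mul_sum, mul_comm]
  rw [h0, div_mul_eq_mul_div, le_div_iff₀ hα]
  have h4 := mul_le_mul_of_nonneg_left (h2.trans (by linarith :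
    _ ≤ 2 * ((Fintype.card J : ℝ) * Fintype.card P))) (mul_pos hγ hα).le
  have h5 := mul_le_mul_of_nonneg_left h1 hγ.le
  linarith

end Approx

theorem sum_indicator_le {Ω : Type*} [Fintype Ω] (p : Ω → Prop) [DecidablePred p] {c : ℝ}
    (h : ((Finset.univ.filter fun ω => ¬ p ω).card : ℝ) ≤ c) :
    ∑ ω, (if p ω then 0 else 1 : ℝ≥0∞) ≤ ENNReal.ofReal c := by
  have : ∑ ω, (if p ω then 0 else 1 : ℝ≥0∞) = ((Finset.univ.filter fun ω => ¬ p ω).card : ℝ≥0∞) := by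
    rw [Finset.card_filter]
    push_cast
    exact Finset.sum_congr rfl fun ω _ => by split_ifs <;> simp_all
  rw [this, ← ENNReal.ofReal_natCast]
  exact ENNReal.ofReal_le_ofReal h

/-! ### Concealing the broad allocation by flips -/

section Flip

variable {J P Q : Type} [DecidableEq P] [DecidableEq Q] {n : ℕ}

/-- Exchange the distinguished slots of a block, or do nothing. -/
def flip (b : Bool) : Equiv.Perm (Slot P Q) :=
  if b then Equiv.swap (.inl none) (.inr none) else 1

theorem sharp_flip (e : Placement J P Q n) (α : ℝ) (m : J → Bool) :
    sharp (twist e fun j => flip (m j)) α = sharp e α := by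
  refine place_twist e _ fun j b => ?_
  cases m j
  · simp [flip]
  · rcases b with (_ | _) | (_ | _) <;>
      simp [flip, sharpWeight, Equiv.swap_apply_def]

theorem innerSlots_flip (e : Placement J P Q n) (m : J → Bool) :
    slotSet (twist e fun j => flip (m j)) (innerSlots P Q) = slotSet e (innerSlots P Q) := by
  refine slotSet_twist e _ fun j b => ?_
  cases m j
  · simp [flip]
  · rcases b with (_ | _) | (_ | _) <;>
      simp [flip, innerSlots, Equiv.swap_apply_def]

/-- For most ways of flipping the distinguished slots, the algorithm disregards the broad
allocation. -/
theorem sum_flip_le [Fintype J] [DecidableEq J] {D : Fin n → Set ℝ} (e : Placement J P Q n) (α γ : ℝ) (L : ℕ) (v : Profile D) :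
    ∑ m : J → Bool, (if mixedRule (twist e fun j => flip (m j)) α γ L v =
        prefer (sharp e α) (flat n γ) v then 0 else 1 : ℝ≥0∞) ≤
      Fintype.card (J → Bool) * ENNReal.ofReal ((2 / 3) ^ L) := by
  classical
  rw [← ENNReal.ofReal_natCast, ← ENNReal.ofReal_mul (by positivity)]
  refine sum_indicator_le _ (card_flip_le
    (fun j b => (v (e (j, flip b (.inl none))) : ℝ) = 1) L _ fun m hm => ?_)
  have hne := (Finset.mem_filter.1 hm).2
  by_contra hlt
  refine hne ?_
  unfold mixedRule
  rw [if_neg, sharp_flip]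
  rintro ⟨h, -⟩
  refine hlt (le_trans (le_of_eq ?_) h)
  congr 2
  refine Finset.sum_congr rfl fun j _ => ?_
  refine if_congr ?_ rfl rfl
  -- The right distinguished agent is the left one of the opposite flip, which gives the form
  -- required by `card_flip_le`.
  have hs : (flip (!m j) (.inl none) : Slot P Q) = flip (m j) (.inr none) := by
    cases m j <;> simp [flip]
  change (v (e (j, flip (!m j) (.inl none))) : ℝ) = 1 ↔
    (v (e (j, flip (m j) (.inr none))) : ℝ) = 1
  rw [hs]

/-- Averaged over the placements, the broad allocation is rarely returned at the profile of the
inner slots. -/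
theorem sum_run_broad_le [Fintype J] [Nonempty J] {ℓ : ℝ} {α γ : ℝ} (hα : α < 1) (hγα : γ ≠ α)
    (L B : ℕ)
    (t : Profile (fun _ : Fin n => ({ℓ, 1} : Set ℝ)) →
      Program (fun _ : Fin n => ({ℓ, 1} : Set ℝ)))
    (ht : ∀ A v, (t v).time A ≤ B)
    (htF : ∀ (F : Set (Allocation n)) A, (∀ v, A v ∈ F) → ∀ v, ∀ x ∈ ((t v).run A).support, x ∈ F)
    [Fintype (Placement J P Q n)] :
    ∑ e : Placement J P Q n, (t (highProfile ℓ (slotSet e (innerSlots P Q)))).run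
        (mixedRule e α γ L) (broad e α) ≤
      Fintype.card (Placement J P Q n) * (B * ENNReal.ofReal ((2 / 3) ^ L)) := by
  classical
  refine sum_placement_le (M := J → Bool) (fun m j => flip (m j)) _ _ fun e => ?_
  simp only [innerSlots_flip]
  set v := highProfile ℓ (slotSet e (innerSlots P Q))
  refine (Program.sum_run_le _ (prefer (sharp e α) (flat n γ)) _
    (sum_flip_le e α γ L) _ (t v)).trans ?_
  -- The comparison black box returns only sharp or flat, so feasibility for that two-element menu
  -- forbids returning broad.
  have h0 : ∀ m : J → Bool, (t v).run (prefer (sharp e α) (flat n γ))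
      (broad (twist e fun j => flip (m j)) α) = 0 := by
    intro m
    by_contra h
    have := htF {sharp e α, flat n γ} (prefer (sharp e α) (flat n γ))
      (fun v => by unfold prefer; split_ifs <;> simp) v _ ((PMF.mem_support_iff _ _).2 h)
    rcases this with h | h
    · rw [← sharp_flip e α m] at h
      exact sharp_ne_broad _ hα h.symm
    · exact broad_ne_flat _ hγα h
  simp only [h0, Finset.sum_const_zero, zero_add]
  rw [mul_left_comm]
  gcongr
  exact_mod_cast ht _ v

end Flip

/-! ### Concealing the sharp allocation by resampling -/

section Resample

variable {J P Q : Type} [DecidableEq P] [DecidableEq Q] {n : ℕ} {ℓ : ℝ}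

/-- Move the distinguished slots of a block to the given positions. -/
def resample (x : Option P × Option Q) : Equiv.Perm (Slot P Q) :=
  Equiv.sumCongr (Equiv.swap none x.1) (Equiv.swap none x.2)

theorem broad_resample (e : Placement J P Q n) (α : ℝ) (m : J → Option P × Option Q) :
    broad (twist e fun j => resample (m j)) α = broad e α := by
  refine place_twist e _ fun j b => ?_
  rcases b with _ | _ <;> simp [resample, broadWeight]

theorem broadSlots_resample (e : Placement J P Q n) (m : J → Option P × Option Q) :
    slotSet (twist e fun j => resample (m j)) (broadSlots P Q) = slotSet e (broadSlots P Q) := by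
  refine slotSet_twist e _ fun j b => ?_
  rcases b with _ | _ <;> simp [resample, broadSlots]

/-- For most positions of the distinguished slots, the algorithm returns the better one of the
flat and the broad allocation. -/
theorem sum_resample_le [Fintype J] [DecidableEq J] [Fintype P] [Fintype Q]
    (hℓ : 0 < ℓ) (hℓ' : ℓ ≤ 1 / 2) (e : Placement J P Q n) {α γ : ℝ}
    (hα : α = 1 / Fintype.card (Option P)) (hγ : 0 < γ) (L : ℕ)
    (hL : 32 * L ≤ γ * (ℓ * n)) (hJ : (Fintype.card J : ℝ) ≤ γ * n / 2)
    (hQ : 32 ≤ γ * Fintype.card (Option Q))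
    (v : Profile (fun _ : Fin n => ({ℓ, 1} : Set ℝ))) [DecidableEq (Allocation n)]
    [Decidable (welfare (flat n γ) v < welfare (broad e α) v)] :
    ∑ m : J → Option P × Option Q, (if mixedRule (twist e fun j => resample (m j)) α γ L v =
        (if welfare (flat n γ) v < welfare (broad e α) v then broad e α else flat n γ)
        then 0 else 1 : ℝ≥0∞) ≤
      Fintype.card (J → Option P × Option Q) * ENNReal.ofReal (3 * Real.exp (-L)) := by
  classical
  rw [← ENNReal.ofReal_natCast, ← ENNReal.ofReal_mul (by positivity)]
  refine sum_indicator_le _ ?_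
  set qX : J → Option P × Option Q → Prop := fun j x => (v (e (j, .inl x.1)) : ℝ) = 1 with hqX
  set qY : J → Option P × Option Q → Prop := fun j x => (v (e (j, .inr x.2)) : ℝ) = 1 with hqY
  have hX : ∀ m : J → Option P × Option Q,
      highCount (twist e fun j => resample (m j)) (.inl none) v = hits qX m := by
    intro m
    refine Finset.sum_congr rfl fun j _ => if_congr ?_ rfl rfl
    have hs : (resample (m j) (.inl none) : Slot P Q) = .inl (m j).1 := by simp [resample]
    change (v (e (j, resample (m j) (.inl none))) : ℝ) = 1 ↔ (v (e (j, .inl (m j).1)) : ℝ) = 1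
    rw [hs]
  have hY : ∀ m : J → Option P × Option Q,
      highCount (twist e fun j => resample (m j)) (.inr none) v = hits qY m := by
    intro m
    refine Finset.sum_congr rfl fun j _ => if_congr ?_ rfl rfl
    have hs : (resample (m j) (.inr none) : Slot P Q) = .inr (m j).2 := by simp [resample]
    change (v (e (j, resample (m j) (.inr none))) : ℝ) = 1 ↔ (v (e (j, .inr (m j).2)) : ℝ) = 1
    rw [hs]
  have hD : (0 : ℝ) < Fintype.card (Option P) := by exact_mod_cast Fintype.card_pos
  have hE : (0 : ℝ) < Fintype.card (Option Q) := by exact_mod_cast Fintype.card_pos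
  have hα0 : 0 < α := by rw [hα]; positivity
  -- Since `α` is the reciprocal of the number of left slots in a block, the mean number of high
  -- left distinguished agents is the welfare of broad up to the low values (`hT1`, `hT2`).
  have hμ : meanHits qX = α * ∑ j, ∑ i, if (v (e (j, .inl i)) : ℝ) = 1 then 1 else 0 := by
    rw [Finset.mul_sum]
    refine Finset.sum_congr rfl fun j _ => ?_
    rw [Fintype.sum_prod_type]
    simp only [hqX, Finset.sum_const, Finset.card_univ, Fintype.card_prod, nsmul_eq_mul,
      ← Finset.mul_sum, hα]
    push_cast
    field_simp
  have hν : (∑ j, ∑ k, if (v (e (j, .inr k)) : ℝ) = 1 then 1 else 0) =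
      Fintype.card (Option Q) * meanHits qY := by
    unfold meanHits
    rw [Finset.mul_sum]
    refine Finset.sum_congr rfl fun j _ => ?_
    rw [Fintype.sum_prod_type]
    simp only [hqY, Finset.sum_const, Finset.card_univ, Fintype.card_prod, nsmul_eq_mul]
    push_cast
    field_simp
  have hT1 : meanHits qX ≤ welfare (broad e α) v := by
    rw [hμ, welfare_broad]
    exact mul_le_mul_of_nonneg_left (Finset.sum_le_sum fun j _ => Finset.sum_le_sum fun i _ =>
      le_value hℓ v _) hα0.le
  have hT2 : welfare (broad e α) v ≤ meanHits qX + ℓ * Fintype.card J := by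
    rw [hμ, welfare_broad]
    calc _ ≤ α * ∑ j, ∑ i, ((if (v (e (j, .inl i)) : ℝ) = 1 then 1 else 0) + ℓ) :=
          mul_le_mul_of_nonneg_left (Finset.sum_le_sum fun j _ => Finset.sum_le_sum fun i _ =>
            value_le hℓ v _) hα0.le
      _ = _ := by
          simp only [Finset.sum_add_distrib, mul_add]
          congr 1
          simp only [Finset.sum_const, Finset.card_univ, nsmul_eq_mul, hα]
          field_simp
  have h0 := welfare_flat_ge hℓ' hγ.le e v
  have hν0 := meanHits_nonneg qY
  have hμ0 := meanHits_nonneg qX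
  have hν' : 32 * meanHits qY ≤ γ * (Fintype.card (Option Q) * meanHits qY) := by
    rw [← mul_assoc]
    exact mul_le_mul_of_nonneg_right hQ hν0
  have hJ' : ℓ * Fintype.card J ≤ γ * (ℓ * n) / 2 := by
    have := mul_le_mul_of_nonneg_left hJ hℓ.le
    linarith
  rw [hν, mul_add] at h0
  set s1 : Finset (J → Option P × Option Q) :=
    Finset.univ.filter fun m => 2 * meanHits qX + L < hits qX m
  set s2 : Finset (J → Option P × Option Q) :=
    Finset.univ.filter fun m => 2 * meanHits qY + L < hits qY m
  set s3 : Finset (J → Option P × Option Q) :=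
    Finset.univ.filter fun m => hits qX m < meanHits qX / 4 - L
  have hL0 : (0 : ℝ) ≤ L := by positivity
  have hsub : (Finset.univ.filter fun m : J → Option P × Option Q =>
      ¬ mixedRule (twist e fun j => resample (m j)) α γ L v =
        (if welfare (flat n γ) v < welfare (broad e α) v then broad e α else flat n γ)) ⊆
      s1 ∪ s2 ∪ s3 := by
    intro m hm
    have hne := (Finset.mem_filter.1 hm).2
    by_contra hmem
    simp only [s1, s2, s3, Finset.mem_union, Finset.mem_filter, Finset.mem_univ, true_and,
      not_or, not_lt] at hmem
    obtain ⟨⟨m1, m2⟩, m3⟩ := hmem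
    refine hne ?_
    have hS := welfare_sharp_le hℓ hα0.le (twist e fun j => resample (m j)) v
    unfold mixedRule prefer
    rw [hX, hY, broad_resample] at hS
    rw [hX, hY, broad_resample]
    by_cases hc : welfare (flat n γ) v < welfare (broad e α) v
    · have hC : 2 * hits qY m + L ≤ hits qX m := by linarith
      rw [if_pos (show 2 * hits qY m + L ≤ hits qX m ∧
          welfare (flat n γ) v < welfare (broad e α) v from ⟨hC, hc⟩),
        if_pos hc, if_pos]
      linarith
    · rw [if_neg (show ¬ (2 * hits qY m + L ≤ hits qX m ∧
          welfare (flat n γ) v < welfare (broad e α) v) from fun h => hc h.2),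
        if_neg hc, if_pos]
      linarith
  have h1 := card_hits_gt_le qX L s1 fun m hm => (Finset.mem_filter.1 hm).2
  have h2 := card_hits_gt_le qY L s2 fun m hm => (Finset.mem_filter.1 hm).2
  have h3 := card_hits_lt_le qX L s3 fun m hm => (Finset.mem_filter.1 hm).2
  have h4 : ((s1 ∪ s2 ∪ s3).card : ℝ) ≤ s1.card + s2.card + s3.card := by
    exact_mod_cast (Finset.card_union_le _ _).trans
      (Nat.add_le_add_right (Finset.card_union_le _ _) _)
  have h5 : ((Finset.univ.filter fun m : J → Option P × Option Q =>
      ¬ mixedRule (twist e fun j => resample (m j)) α γ L v =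
        (if welfare (flat n γ) v < welfare (broad e α) v then broad e α else flat n γ)).card : ℝ) ≤
      (s1 ∪ s2 ∪ s3).card := by
    exact_mod_cast Finset.card_le_card hsub
  linarith

/-- Averaged over the placements, the sharp allocation is rarely returned at the profile of the
broad slots. -/
theorem sum_run_sharp_le [Fintype J] [Fintype P] [Fintype Q] [Nonempty J]
    (hℓ : 0 < ℓ) (hℓ' : ℓ ≤ 1 / 2) {α γ : ℝ} (hα' : α < 1)
    (hα : α = 1 / Fintype.card (Option P)) (hγ : 0 < γ) (hγ' : γ < 1) (L B : ℕ)
    (hL : 32 * L ≤ γ * (ℓ * n)) (hJ : (Fintype.card J : ℝ) ≤ γ * n / 2)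
    (hQ : 32 ≤ γ * Fintype.card (Option Q))
    (t : Profile (fun _ : Fin n => ({ℓ, 1} : Set ℝ)) →
      Program (fun _ : Fin n => ({ℓ, 1} : Set ℝ)))
    (ht : ∀ A v, (t v).time A ≤ B)
    (htF : ∀ (F : Set (Allocation n)) A, (∀ v, A v ∈ F) → ∀ v, ∀ x ∈ ((t v).run A).support, x ∈ F)
    [Fintype (Placement J P Q n)] :
    ∑ e : Placement J P Q n, (t (highProfile ℓ (slotSet e (broadSlots P Q)))).run
        (mixedRule e α γ L) (sharp e α) ≤
      Fintype.card (Placement J P Q n) * (B * ENNReal.ofReal (3 * Real.exp (-L))) := by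
  classical
  refine sum_placement_le (M := J → Option P × Option Q) (fun m j => resample (m j)) _ _
    fun e => ?_
  simp only [broadSlots_resample]
  set v := highProfile ℓ (slotSet e (broadSlots P Q))
  set A' : DetAlgorithm (fun _ : Fin n => ({ℓ, 1} : Set ℝ)) := fun v =>
    if welfare (flat n γ) v < welfare (broad e α) v then broad e α else flat n γ with hA'
  refine (Program.sum_run_le _ A' _
    (fun v => sum_resample_le hℓ hℓ' e hα hγ L hL hJ hQ v) _ (t v)).trans ?_
  have h0 : ∀ m : J → Option P × Option Q, (t v).run A'
      (sharp (twist e fun j => resample (m j)) α) = 0 := by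
    intro m
    by_contra h
    have := htF {broad e α, flat n γ} A'
      (fun v => by simp only [hA']; split_ifs <;> simp) v _ ((PMF.mem_support_iff _ _).2 h)
    rcases this with h | h
    · rw [← broad_resample e α m] at h
      exact sharp_ne_broad _ hα' h
    · exact sharp_ne_flat _ hγ' h
  simp only [h0, Finset.sum_const_zero, zero_add]
  rw [mul_left_comm]
  gcongr
  exact_mod_cast ht _ v

end Resample

/-! ### Fixing a placement and applying truthfulness -/

theorem expect_le_of_le_indicator {n : ℕ} {μ : PMF (Allocation n)} {F : Finset (Allocation n)}
    (hμ : ∀ x ∈ μ.support, x ∈ F) [DecidableEq (Allocation n)] {f : Allocation n → ℝ} {c k : ℝ}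
    {a b : Allocation n} (ha : a ∈ F) (hb : b ∈ F)
    (h : ∀ x ∈ F, f x ≤ c + (if x = a then 1 else 0) + k * (if x = b then 1 else 0)) :
    expect μ f ≤ c + (μ a).toReal + k * (μ b).toReal := by
  refine (expect_mono hμ h).trans (le_of_eq ?_)
  rw [expect_eq_sum hμ]
  simp only [mul_add, Finset.sum_add_distrib, ← Finset.sum_mul, sum_toReal_eq_one hμ]
  simp [ha, hb, mul_comm]

section Main

variable {J P Q : Type} [Fintype J] [Fintype P] [Fintype Q] {n : ℕ} {ℓ : ℝ}

/-- Both failure probabilities are small on average over placements; bounding their sum makes one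
placement serve both profiles. -/
theorem exists_placement [Nonempty J] (hℓ : 0 < ℓ) (hℓ' : ℓ ≤ 1 / 2) {α γ : ℝ}
    (hα' : α < 1) (hα : α = 1 / Fintype.card (Option P)) (hγ : 0 < γ) (hγα : γ < α) (L B : ℕ)
    (hL : 32 * L ≤ γ * (ℓ * n)) (hJ : (Fintype.card J : ℝ) ≤ γ * n / 2)
    (hQ : 32 ≤ γ * Fintype.card (Option Q)) (hn : Fintype.card (J × Slot P Q) ≤ n)
    (t : Profile (fun _ : Fin n => ({ℓ, 1} : Set ℝ)) →
      Program (fun _ : Fin n => ({ℓ, 1} : Set ℝ)))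
    (ht : ∀ A v, (t v).time A ≤ B)
    (htF : ∀ (F : Set (Allocation n)) A, (∀ v, A v ∈ F) → ∀ v, ∀ x ∈ ((t v).run A).support, x ∈ F) :
    ∃ e : Placement J P Q n,
      ((t (highProfile ℓ (slotSet e (innerSlots P Q)))).run
        (mixedRule e α γ L) (broad e α)).toReal +
      ((t (highProfile ℓ (slotSet e (broadSlots P Q)))).run
        (mixedRule e α γ L) (sharp e α)).toReal ≤ B * ((2 / 3) ^ L + 3 * Real.exp (-L)) := by
  classical
  have : Nonempty (Placement J P Q n) :=
    Function.Embedding.nonempty_of_card_le (by simpa using hn)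
  have h1 := sum_run_broad_le (J := J) (P := P) (Q := Q) hα' hγα.ne L B t ht htF
  have h2 := sum_run_sharp_le (J := J) (P := P) (Q := Q) hℓ hℓ' hα' hα hγ (hγα.trans hα') L B
    hL hJ hQ t ht htF
  by_contra! hcon
  set C : ℝ≥0∞ := B * ENNReal.ofReal ((2 / 3) ^ L) + B * ENNReal.ofReal (3 * Real.exp (-L)) with hC
  have hC' : C = ENNReal.ofReal (B * ((2 / 3) ^ L + 3 * Real.exp (-L))) := by
    rw [hC, ← mul_add, ← ENNReal.ofReal_add (by positivity) (by positivity),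
      ← ENNReal.ofReal_natCast, ← ENNReal.ofReal_mul (by positivity)]
  have h3 : ∑ _e : Placement J P Q n, C < ∑ e : Placement J P Q n,
      ((t (highProfile ℓ (slotSet e (innerSlots P Q)))).run (mixedRule e α γ L) (broad e α) +
      (t (highProfile ℓ (slotSet e (broadSlots P Q)))).run (mixedRule e α γ L) (sharp e α)) := by
    refine ENNReal.sum_lt_sum_of_nonempty Finset.univ_nonempty fun e _ => ?_
    have := hcon e
    rw [← ENNReal.toReal_add (PMF.apply_ne_top _ _) (PMF.apply_ne_top _ _)] at this
    rw [hC']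
    exact (ENNReal.ofReal_lt_iff_lt_toReal (by positivity)
      (ENNReal.add_ne_top.2 ⟨PMF.apply_ne_top _ _, PMF.apply_ne_top _ _⟩)).2 this
  refine absurd (h3.trans_le (Finset.sum_add_distrib.trans_le (add_le_add h1 h2)))
    (not_lt.2 (le_of_eq ?_))
  rw [Finset.sum_const, Finset.card_univ, nsmul_eq_mul, hC, mul_add]

/-- At the inner profile, welfare relative to sharp is at most `2 * γ / α` from flat plus the
probabilities of broad and of sharp. The latter is at most `α + γ` plus the probability of sharp at
the broad profile, by monotonicity. -/
theorem approx_transform_le [Nonempty J] (hℓ : 0 < ℓ) (hℓ' : ℓ ≤ 1 / 2) {α γ δ : ℝ}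
    (hα : 0 < α) (hα' : α ≤ 1) (hγ : 0 < γ)
    (hn : ℓ * n ≤ Fintype.card J * Fintype.card P)
    (e : Placement J P Q n) (B : Algorithm (fun _ : Fin n => ({ℓ, 1} : Set ℝ)))
    (hB : B.IsFor (menu e α γ : Set (Allocation n))) (hTIE : B.IsTIE)
    (hδ : (B (highProfile ℓ (slotSet e (innerSlots P Q))) (broad e α)).toReal +
      (B (highProfile ℓ (slotSet e (broadSlots P Q))) (sharp e α)).toReal ≤ δ) :
    approx (menu e α γ : Set (Allocation n)) B ≤ α + γ + 2 * γ / α + δ := by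
  classical
  set v := highProfile ℓ (slotSet e (innerSlots P Q)) with hv
  set u := highProfile ℓ (slotSet e (broadSlots P Q)) with hu
  have hB' : ∀ v, ∀ x ∈ (B v).support, x ∈ menu e α γ := fun v x hx => by simpa using hB v x hx
  have hsm : sharp e α ∈ menu e α γ := mem_menu.2 (by simp)
  have hbm : broad e α ∈ menu e α γ := mem_menu.2 (by simp)
  have hs1 : ∀ j, sharp e α (e (j, .inl none)) = 1 := fun j => place_apply _ _ _
  have hb1 : ∀ j, broad e α (e (j, .inl none)) = α := fun j => place_apply _ _ _
  set j₀ : J := Classical.arbitrary J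
  -- The left distinguished agents all get `γ`, all `α`, or all `1`, so the amount of the single
  -- agent in block `j₀` represents them all.
  have hmono := hTIE.expect_le_union (by linarith) hB (fun x => x (e (j₀, .inl none)))
    (slotSet e (innerSlots P Q)) (Finset.univ.image fun j : J => e (j, .inl none)) (by
      intro x hx i hi
      obtain ⟨j, -, rfl⟩ := Finset.mem_image.1 hi
      rcases mem_menu.1 hx with rfl | rfl | rfl
      · rfl
      · rw [hb1, hb1]
      · rw [hs1, hs1])
  rw [← slotSet_broadSlots, ← hv, ← hu] at hmono
  have hlow : (B v (sharp e α)).toReal ≤ expect (B v) fun x => x (e (j₀, .inl none)) := by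
    rw [expect_eq_sum (hB' v)]
    refine le_trans (le_of_eq ?_) (Finset.single_le_sum (fun x hx =>
      mul_nonneg ENNReal.toReal_nonneg (menu_nonneg e hα.le hγ.le hx _)) hsm)
    rw [hs1, mul_one]
  have hup : expect (B u) (fun x => x (e (j₀, .inl none))) ≤
      α + γ + (B u (sharp e α)).toReal + 0 * (B u (sharp e α)).toReal := by
    refine expect_le_of_le_indicator (hB' u) hsm hsm fun x hx => ?_
    rcases mem_menu.1 hx with rfl | rfl | rfl
    · simp only [flat]
      split_ifs <;> linarith
    · rw [hb1]
      split_ifs <;> linarith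
    · rw [hs1, if_pos rfl]
      linarith
  set s := welfare (sharp e α) v with hs
  have hs0 : 0 < s := welfare_menu_pos hℓ e hα hγ v hsm
  have hfl := flat_le_sharp hℓ e hα hγ hn
  rw [← hv, ← hs] at hfl
  have hbs : welfare (broad e α) v ≤ s :=
    welfare_mono hℓ v (place_le_place e (broadWeight_le hα'))
  have hr : 0 ≤ 2 * γ / α := by positivity
  have hexp : expect (B v) (fun x => s⁻¹ * welfare x v - 0) ≤
      2 * γ / α + (B v (sharp e α)).toReal + 1 * (B v (broad e α)).toReal := by
    refine expect_le_of_le_indicator (hB' v) hsm hbm fun x hx => ?_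
    rw [sub_zero, inv_mul_le_iff₀ hs0]
    have hrs : 0 ≤ s * (2 * γ / α) := by positivity
    rcases mem_menu.1 hx with rfl | rfl | rfl
    · split_ifs <;> nlinarith
    · rw [if_pos (rfl : broad e α = broad e α)]
      split_ifs <;> nlinarith
    · rw [if_pos (rfl : sharp e α = sharp e α)]
      split_ifs <;> nlinarith
  rw [expect_mul_sub (hB' v), sub_zero, inv_mul_le_iff₀ hs0] at hexp
  refine (approx_le hℓ e hα hγ hB v).trans ?_
  rw [div_le_iff₀ (opt_menu_pos hℓ e hα hγ v)]
  have hδ0 : 0 ≤ δ := le_trans (add_nonneg ENNReal.toReal_nonneg ENNReal.toReal_nonneg) hδ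
  calc expect (B v) (fun x => welfare x v) ≤ s * (α + γ + 2 * γ / α + δ) :=
        hexp.trans (mul_le_mul_of_nonneg_left (by linarith) hs0.le)
    _ ≤ (α + γ + 2 * γ / α + δ) * opt (menu e α γ : Set (Allocation n)) v := by
        rw [mul_comm]
        exact mul_le_mul_of_nonneg_left (le_opt _ v hsm) (by positivity)

end Main

/-! ### Choice of parameters and asymptotics -/

open Filter Topology

/-- The base of the parameters for `n` agents. -/
noncomputable def scale (n : ℕ) : ℕ := ⌊(n : ℝ) ^ (1 / 20 : ℝ)⌋₊

open Classical in
/-- The low value for `n` agents. -/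
noncomputable def lowValue (n : ℕ) : ℝ :=
  -- The value `1 / 2` is a default that keeps the low value admissible for small `n`; it is not
  -- used once `2 ≤ scale n`.
  if 0 < (scale n : ℝ) ^ 12 / n ∧ (scale n : ℝ) ^ 12 / n ≤ 1 / 2
    then (scale n : ℝ) ^ 12 / n else 1 / 2

theorem lowValue_pos (n : ℕ) : 0 < lowValue n := by
  unfold lowValue
  split_ifs with h
  · exact h.1
  · norm_num

theorem lowValue_le (n : ℕ) : lowValue n ≤ 1 / 2 := by
  unfold lowValue
  split_ifs with h
  · exact h.2
  · norm_num

theorem tendsto_scale : Tendsto scale atTop atTop :=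
  tendsto_nat_floor_atTop.comp
    ((tendsto_rpow_atTop (by norm_num)).comp tendsto_natCast_atTop_atTop)

theorem scale_le (n : ℕ) : (scale n : ℝ) ≤ (n : ℝ) ^ (1 / 20 : ℝ) :=
  Nat.floor_le (by positivity)

theorem lt_scale_add_one (n : ℕ) : (n : ℝ) ^ (1 / 20 : ℝ) < scale n + 1 :=
  Nat.lt_floor_add_one _

theorem rpow_one_div_pow (n : ℕ) : ((n : ℝ) ^ (1 / 20 : ℝ)) ^ 20 = n := by
  rw [← Real.rpow_natCast, ← Real.rpow_mul (by positivity)]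
  norm_num

theorem scale_pow_le (n : ℕ) : (scale n : ℝ) ^ 20 ≤ n := by
  rw [← rpow_one_div_pow n]
  exact pow_le_pow_left₀ (by positivity) (scale_le n) _

theorem le_scale_add_one_pow (n : ℕ) : n ≤ (scale n + 1) ^ 20 := by
  have : (n : ℝ) ≤ (scale n + 1 : ℝ) ^ 20 := by
    rw [← rpow_one_div_pow n]
    exact pow_le_pow_left₀ (by positivity) (lt_scale_add_one n).le _
  exact_mod_cast this

theorem lowValue_eq {n : ℕ} (h : 2 ≤ scale n) : lowValue n * n = (scale n : ℝ) ^ 12 := by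
  have h2 : (2 : ℝ) ≤ scale n := by exact_mod_cast h
  have hn := scale_pow_le n
  have h12 : (0 : ℝ) < (scale n : ℝ) ^ 12 := by positivity
  have h8 : (2 : ℝ) ≤ (scale n : ℝ) ^ 8 := h2.trans (le_self_pow₀ (by linarith) (by norm_num))
  have hn0 : (0 : ℝ) < n := lt_of_lt_of_le (by positivity) hn
  unfold lowValue
  rw [if_pos, div_mul_cancel₀ _ hn0.ne']
  refine ⟨by positivity, ?_⟩
  rw [div_le_iff₀ hn0]
  nlinarith

theorem eval_le_eval_one_mul_pow (p : Polynomial ℕ) {m : ℕ} (hm : 1 ≤ m) :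
    p.eval m ≤ p.eval 1 * m ^ p.natDegree := by
  rw [Polynomial.eval_eq_sum_range, Polynomial.eval_eq_sum_range, Finset.sum_mul]
  refine Finset.sum_le_sum fun i hi => ?_
  rw [one_pow, mul_one]
  exact Nat.mul_le_mul_left _ (Nat.pow_le_pow_right hm (by
    have := Finset.mem_range.1 hi; omega))

/-- A polynomial number of steps does not make up for an exponentially small probability. -/
theorem eventually_error_le (p : Polynomial ℕ) : ∀ᶠ n : ℕ in atTop,
    ((p.eval n : ℕ) : ℝ) * ((2 / 3) ^ scale n + 3 * Real.exp (-(scale n : ℝ))) ≤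
      1 / (scale n + 1 : ℝ) := by
  set d := 20 * p.natDegree + 1 with hd
  -- This is applied at `M = scale n + 1`: the error has factor `4 * (2 / 3) ^ K = 6 * (2 / 3) ^ (K
  -- + 1)`, and the extra `1` in `d` pays for the denominator `scale n + 1`.
  have h1 : Tendsto (fun M : ℕ => (6 * ((p.eval 1 : ℕ) : ℝ)) * ((M : ℝ) ^ d * (2 / 3 : ℝ) ^ M)) atTop
      (𝓝 ((6 * ((p.eval 1 : ℕ) : ℝ)) * 0)) :=
    (tendsto_pow_const_mul_const_pow_of_abs_lt_one d (by norm_num [abs_lt])).const_mul _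
  rw [mul_zero] at h1
  have h2 := ((tendsto_add_atTop_iff_nat 1).2 h1).comp tendsto_scale
  filter_upwards [h2.eventually_le_const one_pos, eventually_ge_atTop 1] with n hn hn1
  simp only [Function.comp_apply] at hn
  set K := scale n with hK
  have he : Real.exp (-(K : ℝ)) ≤ (2 / 3) ^ K := by
    have : Real.exp (-1) ≤ 2 / 3 := by
      rw [Real.exp_neg, inv_le_comm₀ (Real.exp_pos _) (by norm_num)]
      linarith [Real.exp_one_gt_d9]
    calc Real.exp (-(K : ℝ)) = Real.exp (-1) ^ K := by rw [← Real.exp_nat_mul]; simp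
      _ ≤ _ := pow_le_pow_left₀ (Real.exp_pos _).le this _
  have hp : ((p.eval n : ℕ) : ℝ) ≤ (p.eval 1 : ℕ) * (K + 1 : ℝ) ^ (20 * p.natDegree) := by
    have h3 := eval_le_eval_one_mul_pow p hn1
    have h4 : n ^ p.natDegree ≤ (K + 1) ^ (20 * p.natDegree) := by
      rw [pow_mul]
      exact Nat.pow_le_pow_left (le_scale_add_one_pow n) _
    exact_mod_cast h3.trans (Nat.mul_le_mul_left _ h4)
  rw [le_div_iff₀ (by positivity)]
  refine le_trans ?_ hn
  calc ((p.eval n : ℕ) : ℝ) * ((2 / 3) ^ K + 3 * Real.exp (-(K : ℝ))) * (K + 1)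
      ≤ ((p.eval 1 : ℕ) * (K + 1 : ℝ) ^ (20 * p.natDegree)) * ((2 / 3) ^ K + 3 * (2 / 3) ^ K) *
        (K + 1) := by gcongr
    _ = _ := by
        push_cast
        rw [hd, pow_succ _ K, pow_succ _ (20 * p.natDegree)]
        ring

end BlackBox

open BlackBox Filter in
theorem mainTheorem1 :
    ∃ c : ℝ, 0 < c ∧
    ∃ low : ℕ → ℝ, (∀ n, 0 < low n ∧ low n < 1) ∧
    ∀ T : BlackBox.Transformation (fun n (_ : Fin n) => ({low n, 1} : Set ℝ)),
      T.IsPolytime → T.IsFeasible → T.IsTIE →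
      ∃ N : ℕ, ∀ n ≥ N,
        ∃ (F : Set (BlackBox.Allocation n))
          (A : BlackBox.DetAlgorithm (fun _ : Fin n => ({low n, 1} : Set ℝ))),
          F.Finite ∧ (∀ x ∈ F, ∀ i, 0 ≤ x i) ∧ A.toAlgorithm.IsFor F ∧
          1 / 6 ≤ BlackBox.approx F A.toAlgorithm ∧
          BlackBox.approx F (T.apply A) ≤ 2 * (n : ℝ) ^ (-(1 / 20) : ℝ) ∧
          (n : ℝ) ^ c ≤ BlackBox.approx F A.toAlgorithm / BlackBox.approx F (T.apply A) := by
  -- With `r = n ^ (1 / 40)` the ratio is at least `r ^ 2 / 12`. The threshold `144 ≤ scale n` gives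
  -- `12 ≤ r`, so halving the exponent `1 / 20` absorbs the constant.
  refine ⟨1 / 40, by norm_num, lowValue,
    fun n => ⟨lowValue_pos n, (lowValue_le n).trans_lt (by norm_num)⟩, fun T hp hF hT => ?_⟩
  obtain ⟨p, hp⟩ := hp
  obtain ⟨N, hN⟩ := eventually_atTop.1
    ((eventually_error_le p).and (tendsto_scale.eventually_ge_atTop 144))
  refine ⟨N, fun n hn => ?_⟩
  obtain ⟨herr, hK⟩ := hN n hn
  have hlow := lowValue_eq (n := n) (by omega)
  have hscale := scale_pow_le n
  have hlt := lt_scale_add_one n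
  have hle := scale_le n
  set K := scale n with hKdef
  have hKR : (144 : ℝ) ≤ K := by exact_mod_cast hK
  have hK0 : (0 : ℝ) < K := by linarith
  have hpow : ∀ k : ℕ, (1 : ℝ) ≤ (K : ℝ) ^ k := fun k => one_le_pow₀ (by linarith)
  -- Now `α`, `γ / α` are of order `K ^ (-2)`, so `α + γ + 2 * γ / α ≤ 4 / K ^ 2 ≤ 1 / (K + 1)`.
  set α : ℝ := 1 / ((K : ℝ) ^ 2 + 1) with hα
  set γ : ℝ := α / (K : ℝ) ^ 2 with hγ
  have hα0 : 0 < α := by positivity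
  have hγ0 : 0 < γ := by positivity
  have hα1 : α < 1 := by
    rw [hα, div_lt_one (by positivity)]
    linarith [hpow 2]
  have hαK : α ≤ 1 / (K : ℝ) ^ 2 := by
    rw [hα]
    exact one_div_le_one_div_of_le (by positivity) (by linarith)
  have hγα : γ < α := by
    rw [hγ, div_lt_iff₀ (by positivity)]
    have : (1 : ℝ) < (K : ℝ) ^ 2 := one_lt_pow₀ (by linarith) (by norm_num)
    nlinarith
  have hγK : 1 ≤ γ * (2 * (K : ℝ) ^ 4) := by
    have : γ * (2 * (K : ℝ) ^ 4) = 2 * (K : ℝ) ^ 2 / ((K : ℝ) ^ 2 + 1) := by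
      rw [hγ, hα]
      field_simp
    rw [this, one_le_div (by positivity)]
    linarith [hpow 2]
  have hmul : ∀ c : ℝ, 0 ≤ c → c ≤ γ * (2 * (K : ℝ) ^ 4 * c) := fun c hc => by
    have := mul_le_mul_of_nonneg_right hγK hc
    linarith
  have hJne : Nonempty (Fin (K ^ 10)) := ⟨⟨0, by positivity⟩⟩
  have hnK : K ^ 20 ≤ n := by exact_mod_cast hscale
  -- With `K ^ 10` blocks and `K ^ 2` inner slots each, there are `K ^ 12` inner agents, exactly
  -- `lowValue n * n`. The `K ^ 9` right slots make `γ * K ^ 9` large although `γ` is of order `K ^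
  -- (-4)`, and all slots still fit into `K ^ 20 ≤ n` agents.
  obtain ⟨e, he⟩ := exists_placement (J := Fin (K ^ 10)) (P := Fin (K ^ 2)) (Q := Fin (K ^ 9))
    (n := n) (lowValue_pos n) (lowValue_le n) (α := α) (γ := γ) hα1 (by simp [hα]) hγ0 hγα K
    (p.eval n) (by
      rw [hlow]
      refine (hmul (32 * K) (by positivity)).trans (mul_le_mul_of_nonneg_left ?_ hγ0.le)
      calc 2 * (K : ℝ) ^ 4 * (32 * (K : ℝ)) = 64 * (K : ℝ) ^ 5 := by ring
        _ ≤ (K : ℝ) * (K : ℝ) ^ 5 := by gcongr; linarith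
        _ = (K : ℝ) ^ 6 := by ring
        _ ≤ (K : ℝ) ^ 12 := pow_le_pow_right₀ (by linarith) (by norm_num))
    (by
      rw [Fintype.card_fin, mul_div_assoc]
      refine (hmul _ (by positivity)).trans (mul_le_mul_of_nonneg_left ?_ hγ0.le)
      rw [le_div_iff₀ (by norm_num)]
      push_cast
      calc 2 * (K : ℝ) ^ 4 * (K : ℝ) ^ 10 * 2 = 4 * (K : ℝ) ^ 14 := by ring
        _ ≤ (K : ℝ) * (K : ℝ) ^ 14 := by gcongr; linarith
        _ = (K : ℝ) ^ 15 := by ring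
        _ ≤ (K : ℝ) ^ 20 := pow_le_pow_right₀ (by linarith) (by norm_num)
        _ ≤ (n : ℝ) := hscale)
    (by
      refine (hmul 32 (by norm_num)).trans (mul_le_mul_of_nonneg_left ?_ hγ0.le)
      rw [Fintype.card_option, Fintype.card_fin]
      push_cast
      calc 2 * (K : ℝ) ^ 4 * 32 = 64 * (K : ℝ) ^ 4 := by ring
        _ ≤ (K : ℝ) * (K : ℝ) ^ 4 := by gcongr; linarith
        _ = (K : ℝ) ^ 5 := by ring
        _ ≤ (K : ℝ) ^ 9 := pow_le_pow_right₀ (by linarith) (by norm_num)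
        _ ≤ _ := by linarith)
    (by
      refine le_trans ?_ hnK
      simp only [Fintype.card_prod, Fintype.card_sum, Fintype.card_option, Fintype.card_fin]
      have h2 : K ^ 2 ≤ K ^ 9 := Nat.pow_le_pow_right (by omega) (by norm_num)
      have h0 : 1 ≤ K ^ 9 := Nat.one_le_pow _ _ (by omega)
      calc K ^ 10 * (K ^ 2 + 1 + (K ^ 9 + 1)) ≤ K ^ 10 * (K ^ 9 * K) :=
            Nat.mul_le_mul_left _ (by nlinarith)
        _ = K ^ 20 := by ring)
    (T n) (hp n) (fun F A hA v => by
      refine hF n F A (fun v x hx => ?_) v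
      rw [DetAlgorithm.toAlgorithm, PMF.support_pure, Set.mem_singleton_iff] at hx
      exact hx ▸ hA v)
  set A : DetAlgorithm (fun _ : Fin n => ({lowValue n, 1} : Set ℝ)) := mixedRule e α γ K with hA
  have hAF : A.toAlgorithm.IsFor (menu e α γ : Set (Allocation n)) := by
    intro v x hx
    rw [DetAlgorithm.toAlgorithm, PMF.support_pure, Set.mem_singleton_iff] at hx
    exact hx ▸ mixedRule_mem e α γ K v
  have hTF := hF n _ A hAF
  have h6 : 1 / 6 ≤ approx (menu e α γ : Set (Allocation n)) A.toAlgorithm :=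
    one_sixth_le_approx_mixedRule (lowValue_pos n) e hα0 hα1.le hγ0 K
  have hpos := approx_pos (lowValue_pos n) e hα0 hγ0 hTF
  have hup : approx (menu e α γ : Set (Allocation n)) (T.apply A) ≤
      2 * (n : ℝ) ^ (-(1 / 20) : ℝ) := by
    refine (approx_transform_le (lowValue_pos n) (lowValue_le n) hα0 hα1.le hγ0
      (by rw [hlow]; simp only [Fintype.card_fin]; push_cast; exact le_of_eq (by ring))
      e (T.apply A) hTF (hT n A) (he.trans herr)).trans ?_
    have h1 : 2 * γ / α = 2 * (1 / (K : ℝ) ^ 2) := by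
      rw [hγ]
      field_simp
    have h2 : 4 * (1 / (K : ℝ) ^ 2) ≤ 1 / (K + 1) := by
      rw [mul_one_div, div_le_div_iff₀ (by positivity) (by positivity)]
      nlinarith
    have h3 : 1 / (K + 1 : ℝ) ≤ (n : ℝ) ^ (-(1 / 20) : ℝ) := by
      rw [Real.rpow_neg (by positivity), ← one_div]
      exact one_div_le_one_div_of_le (by linarith) hlt.le
    rw [h1]
    linarith
  refine ⟨menu e α γ, A, Finset.finite_toSet _, fun x hx => menu_nonneg e hα0.le hγ0.le
    (by simpa using hx), hAF, h6, hup, ?_⟩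
  rw [le_div_iff₀ hpos]
  have hr0 : (0 : ℝ) < (n : ℝ) ^ (1 / 40 : ℝ) := Real.rpow_pos_of_pos
    (lt_of_lt_of_le (by positivity) hscale) _
  have hsq : (n : ℝ) ^ (1 / 20 : ℝ) = (n : ℝ) ^ (1 / 40 : ℝ) * (n : ℝ) ^ (1 / 40 : ℝ) := by
    rw [← Real.rpow_add (lt_of_lt_of_le (by positivity) hscale)]
    norm_num
  rw [Real.rpow_neg (by positivity), hsq] at hup
  rw [hsq] at hle
  set r := (n : ℝ) ^ (1 / 40 : ℝ)
  have h12 : 12 ≤ r := by nlinarith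
  calc r * approx (menu e α γ : Set (Allocation n)) (T.apply A) ≤ r * (2 * (r * r)⁻¹) :=
        mul_le_mul_of_nonneg_left hup hr0.le
    _ = 2 / r := by field_simp
    _ ≤ 2 / 12 := by gcongr
    _ ≤ _ := by linarith
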